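/- **Setting.** Let $\Gamma=\mathbb Z^2\oplus\mathbb Z^2$ be the charge lattice of the $SU(3)$ Seiberg–Witten system; a charge is written $\gamma=(\mathbf g,\mathbf q)=\sum_j g^j\beta_j+\sum_i q_i\alpha^i$ with magnetic part $\mathbf g$ and electric part $\mathbf q$, where $\langle\alpha^i,\beta_j\rangle=\delta_{ij}$ and $\langle\alpha^i,\alpha^j\rangle=\langle\beta_i,\beta_j\rangle=0$, i.e. $\langle(\mathbf g,\mathbf q),(\mathbf g',\mathbf q')\rangle=\mathbf q\cdot\mathbf g'-\mathbf g\cdot\mathbf q'$. As electric charges the positive roots are $\alpha_1=(2,-1)$, $\alpha_2=(-1,2)$, $\alpha_3=\alpha_1+\alpha_2$; as magnetic charges (in simple co-roots) they are $\alpha_1=(1,0)$, $\alpha_2=(0,1)$, $\alpha_3=(1,1)$. Let $\mathfrak g=\bigoplus_{\gamma\in\Gamma}\mathbb Q e_\gamma$ with $[e_\gamma,e_\mu]=(-1)^{\langle\gamma,\mu\rangle}\langle\gamma,\mu\rangle e_{\gamma+\mu}$, and, in the pro-nilpotent group of a strict cone, let $\mathcal K_\gamma=\exp\big(\sum_{k\ge1}e_{k\gamma}/k^2\big)$.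 For linearly independent $\gamma,\gamma'$ the *wall crossing formula* (KSWCF) for $\Omega,\Omega':\Gamma\to\mathbb Q$ on the cone $\mathbb Z_{\ge0}\gamma+\mathbb Z_{\ge0}\gamma'$ is $$\prod_{m/l\searrow}\mathcal K_{m\gamma+l\gamma'}^{\Omega(m\gamma+l\gamma')}=\prod_{m/l\nearrow}\mathcal K_{m\gamma+l\gamma'}^{\Omega'(m\gamma+l\gamma')},$$ where $\Omega$ describes the side on which the ray of $\gamma$ comes first and $\Omega'$ the other side. We say that *crossing from $\Omega$ gives $\mu$ the invariant $v$* if a solution $\Omega'$ exists and every solution has $\Omega'(\mu)=v$. The vanishing cycles are $$\nu_1^+=(\alpha_1,\alpha_1),\ \nu_1^-=(-\alpha_1,0);\quad \nu_2^+=(\alpha_2,0),\ \nu_2^-=(-\alpha_2,\alpha_2);\quad \nu_3^+=(\alpha_3,\alpha_1),\ \nu_3^-=(-\alpha_3,\alpha_2).$$ A *spectrum generated by the vanishing cycles* (the situation where the walls $\mathcal W^1_k$ of the pairs $\nu_k^\pm$ are present) is a map $\Omega:\Gamma\to\mathbb Q$ such that for each $k=1,2,3$ it satisfies the KSWCF on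 the cone of $\nu_k^+,\nu_k^-$, where on the other side, on which the ray of $\nu_k^+$ comes first, only $\nu_k^\pm$ are occupied, with invariant $1$; and such that $\Omega(\mu)=0$ if neither $\mu$ nor $-\mu$ lies in one of the three cones. **Proposition.** Let $n\ge1$ and $$\gamma_1=(-\alpha_1,(n-1)\alpha_1),\qquad \gamma_2=(-\alpha_2,n\alpha_2),\qquad \gamma_3=(-\alpha_3,\alpha_2+(n-1)\alpha_3).$$ 1. $\gamma_3=\gamma_1+\gamma_2$ and $\gamma_3=(n-1)\nu_3^++n\nu_3^-$. 2. A spectrum generated by the vanishing cycles exists, and every such spectrum has $\Omega(\gamma_1)=\Omega(\gamma_2)=\Omega(\gamma_3)=1$. 3. The state of charge $\gamma_3$ can be produced in two ways: crossing from the invariants with only $\nu_3^\pm$ occupied (each with invariant $1$) gives $\gamma_3$ the invariant $1$, and so does crossing from the invariants with only $\gamma_1,\gamma_2$ occupied (each with invariant $1$), on the cones of these pairs (with $\nu_3^+$, respectively $\gamma_1$, coming first). 4. On the cone of $\gamma_1,\gamma_2$, crossing from any spectrum generated by the vanishing cycles (with $\gamma_1$ coming first) gives $\gamma_3$ the invariant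 $2$. 5. For the leading weak-coupling central charge $Z(\gamma)=C\,\mathbf a\cdot\mathbf g$ ($C\neq0$, $\mathbf a=(a^1,a^2)\in\mathbb C^2$), the rays $\mathbb R_{>0}Z(\gamma_1)$ and $\mathbb R_{>0}Z(\gamma_2)$ (with $Z(\gamma_2)\ne 0$) coincide if and only if $a^2\ne0$, $\operatorname{Im}(a^1/a^2)=0$ and $\operatorname{Re}(a^1/a^2)>0$; this is the weak-coupling wall $\mathcal W^1_{\alpha_1,\alpha_2}$. 6. Let $B$ be a topological space, $(Z_b)_{b\in B}$ a continuous family of central charges $Z_b\in\operatorname{Hom}(\Gamma,\mathbb C)$, $(\Omega_b)_{b\in B}$ a family of maps $\Gamma\to\mathbb Q$, and $b_0$ a point of the wall of the first kind $\{b: \mathbb R_{>0}Z_b(\gamma_1)=\mathbb R_{>0}Z_b(\gamma_2)\}$ (with $Z_{b_0}(\gamma_2)\neq 0$). Suppose that near $b_0$ the product $\prod\mathcal K_\gamma^{\Omega_b(\gamma)}$ over the cone of $\gamma_1,\gamma_2$, taken in the clockwise order of the rays $\mathbb R_{>0}Z_b(\gamma)$, does not depend on $b$ (for $b$ with $\operatorname{Im}(Z_b(\gamma_1)\overline{Z_b(\gamma_2)})\ne0$).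 Let $B_\pm=\{b:\pm\operatorname{Im}(Z_b(\gamma_1)\overline{Z_b(\gamma_2)})<0\}$ be the two sides, and suppose that $b_0\in\overline{B_-}$ and that $\Omega_b$ is a spectrum generated by the vanishing cycles for all $b\in B_-$ near $b_0$. Then $\Omega_b(\gamma_3)=1$ for all $b\in B_-$ near $b_0$, and $\Omega_b(\gamma_3)=2$ for all $b\in B_+$ near $b_0$: the DT invariant of $(-\alpha_3,\alpha_2+(n-1)\alpha_3)$ jumps from $1$ to $2$ across the wall. -/

import Mathlib

open Filter Topology

noncomputable section

namespace SU3

/-! ### The charge lattice of the SU(3) system -/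

/-- A charge `γ = (g ; q) = g¹ β₁ + g² β₂ + q₁ α¹ + q₂ α²`: the first component is the magnetic
charge `g`, the second one the electric charge `q`, both in coordinates with respect to a
symplectic basis `α¹, α², β₁, β₂`. -/
abbrev Charge : Type := (Fin 2 → ℤ) × (Fin 2 → ℤ)

/-- The intersection pairing, normalised by `⟨αⁱ, β_j⟩ = δ_ij`. -/
def pairing (γ μ : Charge) : ℤ := (∑ i, γ.2 i * μ.1 i) - ∑ i, γ.1 i * μ.2 i

/-- The positive roots `α₁, α₂, α₃ = α₁ + α₂` as electric charges. -/
def root : Fin 3 → Fin 2 → ℤ := ![![2, -1], ![-1, 2], ![1, 1]]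

/-- The positive roots `α₁, α₂, α₃` as magnetic charges (expressed in the simple co-roots). -/
def coroot : Fin 3 → Fin 2 → ℤ := ![![1, 0], ![0, 1], ![1, 1]]

/-- The vanishing cycles `ν₁⁺ = (α₁, α₁)`, `ν₂⁺ = (α₂, 0)`, `ν₃⁺ = (α₃, α₁)`. -/
def nuPlus : Fin 3 → Charge := ![(coroot 0, root 0), (coroot 1, 0), (coroot 2, root 0)]

/-- The vanishing cycles `ν₁⁻ = (-α₁, 0)`, `ν₂⁻ = (-α₂, α₂)`, `ν₃⁻ = (-α₃, α₂)`. -/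
def nuMinus : Fin 3 → Charge := ![(-coroot 0, 0), (-coroot 1, root 1), (-coroot 2, root 1)]

/-- `γ₁ = (-α₁, (n-1) α₁)`. -/
def gamma1 (n : ℕ) : Charge := (-coroot 0, ((n : ℤ) - 1) • root 0)

/-- `γ₂ = (-α₂, n α₂)`. -/
def gamma2 (n : ℕ) : Charge := (-coroot 1, (n : ℤ) • root 1)

/-- `γ₃ = (-α₃, α₂ + (n-1) α₃)`. -/
def gamma3 (n : ℕ) : Charge := (-coroot 2, root 1 + ((n : ℤ) - 1) • root 2)

/-! ### The graded Lie algebra `𝔤 = ⨁ ℚ e_γ` -/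

/-- The underlying vector space of `𝔤`, with basis `e_γ` (`γ` a charge). -/
def TorusLie : Type := Charge →₀ ℚ

instance : AddCommGroup TorusLie := inferInstanceAs (AddCommGroup (Charge →₀ ℚ))

instance : Module ℚ TorusLie := inferInstanceAs (Module ℚ (Charge →₀ ℚ))

/-- The generator `e_γ`. -/
def e (γ : Charge) : TorusLie := Finsupp.single γ 1

/-- The structure constant `(-1)^⟨γ,μ⟩ ⟨γ,μ⟩`. -/
def coeff (γ μ : Charge) : ℚ := (-1 : ℚ) ^ pairing γ μ * (pairing γ μ : ℚ)

/-- The bilinear extension of `[e_γ, e_μ] = (-1)^⟨γ,μ⟩ ⟨γ,μ⟩ e_{γ+μ}`. -/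
def bracketHom : TorusLie →ₗ[ℚ] TorusLie →ₗ[ℚ] TorusLie :=
  Finsupp.lift (TorusLie →ₗ[ℚ] TorusLie) ℚ Charge fun γ =>
    Finsupp.lift TorusLie ℚ Charge fun μ => coeff γ μ • e (γ + μ)

theorem bracketHom_e (γ μ : Charge) : bracketHom (e γ) (e μ) = coeff γ μ • e (γ + μ) := by
  have key : ∀ {M : Type} [AddCommGroup M] [Module ℚ M] (f : Charge → M) (γ : Charge),
      Finsupp.lift M ℚ Charge f (Finsupp.single γ 1) = f γ := by
    intro M _ _ f γ
    simp
  have h1 : bracketHom (e γ) = Finsupp.lift TorusLie ℚ Charge fun μ => coeff γ μ • e (γ + μ) :=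
    key (M := TorusLie →ₗ[ℚ] TorusLie) _ γ
  rw [h1]
  exact key (M := TorusLie) _ μ

theorem TorusLie.induction {p : TorusLie → Prop} (x : TorusLie) (h0 : p 0)
    (hadd : ∀ x y, p x → p y → p (x + y)) (he : ∀ (c : ℚ) γ, p (c • e γ)) : p x := by
  refine Finsupp.induction_linear (motive := p) x h0 hadd fun γ c => ?_
  have h := he c γ
  have h2 : (c • e γ : TorusLie) = Finsupp.single γ c := by
    show c • (Finsupp.single γ (1 : ℚ)) = Finsupp.single γ c
    simp
  rwa [h2] at h

theorem pairing_add_left (a b c : Charge) : pairing (a + b) c = pairing a c + pairing b c := by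
  simp [pairing, Fin.sum_univ_two]; ring

theorem pairing_add_right (a b c : Charge) : pairing a (b + c) = pairing a b + pairing a c := by
  simp [pairing, Fin.sum_univ_two]; ring

theorem pairing_swap (a b : Charge) : pairing a b = -pairing b a := by
  simp [pairing, Fin.sum_univ_two]; ring

theorem pairing_self (a : Charge) : pairing a a = 0 := by
  simp [pairing, Fin.sum_univ_two]; ring

theorem sign_swap (a b : Charge) : (-1 : ℚ) ^ pairing a b = (-1 : ℚ) ^ pairing b a := by
  rw [pairing_swap a b, zpow_neg, ← inv_zpow, inv_neg_one]

theorem coeff_swap (a b : Charge) : coeff a b = -coeff b a := by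
  rw [coeff, coeff, sign_swap a b, pairing_swap a b, Int.cast_neg, mul_neg]

theorem bracketHom_swap (x y : TorusLie) : bracketHom x y = -bracketHom y x := by
  induction x using TorusLie.induction with
  | h0 => simp
  | hadd a b ha hb => rw [map_add, map_add, LinearMap.add_apply, ha, hb]; abel
  | he c γ =>
    induction y using TorusLie.induction with
    | h0 => simp
    | hadd a b ha hb => rw [map_add, map_add, LinearMap.add_apply, ha, hb]; abel
    | he d μ =>
      simp only [map_smul, LinearMap.smul_apply, bracketHom_e]
      rw [coeff_swap μ γ, add_comm μ γ]
      module

theorem jacobi_e (γ μ ρ : Charge) :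
    bracketHom (e γ) (bracketHom (e μ) (e ρ)) =
      bracketHom (bracketHom (e γ) (e μ)) (e ρ) + bracketHom (e μ) (bracketHom (e γ) (e ρ)) := by
  simp only [map_smul, LinearMap.smul_apply, bracketHom_e]
  rw [← add_assoc γ μ ρ, add_left_comm μ γ ρ, ← add_assoc γ μ ρ]
  have h1 : coeff μ ρ * coeff γ (μ + ρ) =
      coeff γ μ * coeff (γ + μ) ρ + coeff γ ρ * coeff μ (γ + ρ) := by
    have hne : (-1 : ℚ) ≠ 0 := by norm_num
    simp only [coeff, pairing_add_left, pairing_add_right, zpow_add₀ hne, sign_swap μ γ, Int.cast_add]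
    rw [pairing_swap μ γ, Int.cast_neg]
    ring
  simp only [smul_smul, ← add_smul, h1]

theorem bracketHom_jacobi (x y z : TorusLie) :
    bracketHom x (bracketHom y z) =
      bracketHom (bracketHom x y) z + bracketHom y (bracketHom x z) := by
  induction x using TorusLie.induction with
  | h0 => simp
  | hadd a b ha hb => simp only [map_add, LinearMap.add_apply, ha, hb]; abel
  | he c γ =>
    induction y using TorusLie.induction with
    | h0 => simp
    | hadd a b ha hb => simp only [map_add, LinearMap.add_apply, ha, hb]; abel
    | he d μ =>
      induction z using TorusLie.induction with
      | h0 => simp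
      | hadd a b ha hb => simp only [map_add, ha, hb]; abel
      | he f ρ =>
        simp only [map_smul, LinearMap.smul_apply]
        rw [jacobi_e]
        module

instance : LieRing TorusLie where
  bracket x y := bracketHom x y
  add_lie x y z := by simp
  lie_add x y z := by simp
  lie_self x := by
    have h : bracketHom x x = -bracketHom x x := bracketHom_swap x x
    have h2 : (2 : ℚ) • bracketHom x x = 0 := by
      rw [two_smul]; nth_rewrite 1 [h]; simp
    exact (smul_eq_zero.mp h2).resolve_left (by norm_num)
  leibniz_lie x y z := bracketHom_jacobi x y z

instance : LieAlgebra ℚ TorusLie where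
  lie_smul c x y := by
    show bracketHom x (c • y) = c • bracketHom x y
    simp

/-! ### The pro-nilpotent group of a cone and the Kontsevich-Soibelman transforms

Fix the cone `{m γ + l γ' : m, l ≥ 0}` and give `m γ + l γ'` the degree `m + l`. The quotient
`𝔤_{Δ,N}` of the Lie algebra of the cone by the part of degree `> N` acts on
`𝔤[t]/(t^{N+1})`, an element `e_μ` of degree `d` acting as `t^d [e_μ, ·]`. This action is faithful,
because the pairing on the charge lattice is nondegenerate, so the group `G_{Δ,N}` is the group
of operators generated by the exponentials. -/

/-- `𝔤[t]/(t^{N+1})`, an element being the list of its coefficients. -/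
abbrev Trunc (N : ℕ) : Type := Fin (N + 1) → TorusLie

/-- The operator `t^d A` on `𝔤[t]/(t^{N+1})`. -/
def tMul (N d : ℕ) (A : Module.End ℚ TorusLie) : Module.End ℚ (Trunc N) where
  toFun f j := if d ≤ (j : ℕ) then A (f ⟨(j : ℕ) - d, by omega⟩) else 0
  map_add' f g := by
    funext j
    by_cases h : d ≤ (j : ℕ) <;> simp [h]
  map_smul' c f := by
    funext j
    by_cases h : d ≤ (j : ℕ) <;> simp [h]

/-- The logarithm `∑_{k ≥ 1} e_{kγ} / k²` of `𝒦_γ`, where `γ` has degree `d`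
(for `d ≥ 1` the terms with `k > N` vanish in the truncation). -/
def ksLog (N d : ℕ) (γ : Charge) : Module.End ℚ (Trunc N) :=
  ∑ k ∈ Finset.Icc 1 N, (1 / (k : ℚ) ^ 2) • tMul N (k * d) (LieAlgebra.ad ℚ TorusLie (e (k • γ)))

/-- The power `𝒦_γ^c = exp (c ∑_{k ≥ 1} e_{kγ} / k²)` in `G_{Δ,N}`, where `γ` has degree `d`. -/
def ksPow (N d : ℕ) (γ : Charge) (c : ℚ) : Module.End ℚ (Trunc N) :=
  IsNilpotent.exp (c • ksLog N d γ)

/-- The element `𝕊(ℓ) = ∏_{k ≥ 1} 𝒦_{kμ}^{Ω(kμ)}` of `G_{Δ,N}` attached to the ray through the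
primitive element `μ = m γ + l γ'` of the cone, where `p = (m, l)`. -/
def rayElement (N : ℕ) (γ γ' : Charge) (Ω : Charge → ℚ) (p : ℕ × ℕ) :
    Module.End ℚ (Trunc N) :=
  ((List.range N).map fun i =>
    ksPow N ((i + 1) * (p.1 + p.2)) ((i + 1) • (p.1 • γ + p.2 • γ'))
      (Ω ((i + 1) • (p.1 • γ + p.2 • γ')))).prod

/-- `L` lists the rays of the cone that are visible in degree `≤ N` (represented by their
primitive elements `(m, l)`, `m` and `l` coprime) in the order `before`. -/
def IsOrderedRays (before : ℕ × ℕ → ℕ × ℕ → Prop) (N : ℕ) (L : List (ℕ × ℕ)) : Prop :=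
  (∀ p : ℕ × ℕ, p ∈ L ↔ Nat.Coprime p.1 p.2 ∧ p.1 + p.2 ≤ N) ∧ L.Pairwise before

/-- `S` is the image in `G_{Δ,N}` of the product of the `𝕊(ℓ)` over all rays of the cone spanned by
`γ` and `γ'`, taken in the order `before`. -/
def IsOrderedProduct (before : ℕ × ℕ → ℕ × ℕ → Prop) (γ γ' : Charge) (Ω : Charge → ℚ)
    (N : ℕ) (S : Module.End ℚ (Trunc N)) : Prop :=
  ∃ L, IsOrderedRays before N L ∧ S = (L.map (rayElement N γ γ' Ω)).prod

/-- The order of the rays of the cone from `γ = (1, 0)` to `γ' = (0, 1)`: `m / l` decreases. -/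
def fromFirst (p q : ℕ × ℕ) : Prop := q.1 * p.2 < p.1 * q.2

/-- The order of the rays of the cone from `γ' = (0, 1)` to `γ = (1, 0)`: `m / l` increases. -/
def fromSecond (p q : ℕ × ℕ) : Prop := p.1 * q.2 < q.1 * p.2

/-- The wall crossing formula of Kontsevich and Soibelman
`∏_{m/l ↘} 𝒦_{mγ+lγ'}^{Ω(mγ+lγ')} = ∏_{m/l ↗} 𝒦_{mγ+lγ'}^{Ω'(mγ+lγ')}`, that is, equality of
all truncations; `Ω` are the invariants on the side where the ray of `γ` comes first, `Ω'` those
on the other side. -/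
def KSWCF (γ γ' : Charge) (Ω Ω' : Charge → ℚ) : Prop :=
  ∀ N : ℕ, ∃ S : Module.End ℚ (Trunc N),
    IsOrderedProduct fromFirst γ γ' Ω N S ∧ IsOrderedProduct fromSecond γ γ' Ω' N S

/-- With the invariants `Ω` on the side of the wall where the ray of `γ` comes first, the wall
crossing formula has a solution on the other side, and the invariant of the charge `μ` in every
solution is `v`. -/
def CrossingGives (γ γ' : Charge) (Ω : Charge → ℚ) (μ : Charge) (v : ℚ) : Prop :=
  (∃ Ω', KSWCF γ γ' Ω Ω') ∧ ∀ Ω', KSWCF γ γ' Ω Ω' → Ω' μ = v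

/-- The invariants for which only the two charges `γ, γ'` are occupied, with invariant `1`. -/
def twoStates (γ γ' : Charge) : Charge → ℚ := fun μ => if μ = γ ∨ μ = γ' then 1 else 0

/-! ### The spectrum on the side where the three walls `𝒲ₖ` are present -/

/-- The membership of a charge in the cone spanned by `γ` and `γ'`. -/
def InCone (γ γ' μ : Charge) : Prop := ∃ m l : ℕ, μ = m • γ + l • γ'

/-- `Ω` is a spectrum produced from the initial data `Ω(νₖ^±) = 1` by crossing, for `k = 1, 2, 3`,
the wall `𝒲ₖ` of the pair `νₖ^±`: on the cone of `νₖ^±` it solves the wall crossing formula with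
these two states on the other side, and no charge is occupied that is not, up to sign
(antiparticles), in one of the three cones. -/
structure IsGeneratedSpectrum (Ω : Charge → ℚ) : Prop where
  crossing : ∀ k : Fin 3,
    KSWCF (nuPlus k) (nuMinus k) (twoStates (nuPlus k) (nuMinus k)) Ω
  vanishing : ∀ μ : Charge,
    (∀ k : Fin 3, ¬ InCone (nuPlus k) (nuMinus k) μ ∧ ¬ InCone (nuPlus k) (nuMinus k) (-μ)) →
      Ω μ = 0

/-! ### Central charges and walls of the first kind -/

/-- The rays `ℝ_{>0} Z(γ)` and `ℝ_{>0} Z(γ')` coincide. -/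
def Aligned (Z : Charge →+ ℂ) (γ γ' : Charge) : Prop :=
  Z γ' ≠ 0 ∧ ∃ r : ℝ, 0 < r ∧ Z γ = (r : ℂ) * Z γ'

/-- The wall of the first kind `𝒲_{γ,γ'}` in the base of a family of central charges. -/
def wall {B : Type*} (Z : B → Charge →+ ℂ) (γ γ' : Charge) : Set B := {b | Aligned (Z b) γ γ'}

/-- `Im (Z(γ) / Z(γ'))`, up to a positive factor. If it is positive, then the ray of `γ` precedes
the ray of `γ'` in the clockwise order of the sector that they span. -/
def turn (Z : Charge →+ ℂ) (γ γ' : Charge) : ℝ := (Z γ * star (Z γ')).im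

/-- The clockwise order of the rays `ℝ_{>0} Z(m γ + l γ')`. -/
def clockwise (Z : Charge →+ ℂ) (γ γ' : Charge) (p q : ℕ × ℕ) : Prop :=
  0 < turn Z (p.1 • γ + p.2 • γ') (q.1 • γ + q.2 • γ')

/-- The family `(Z_b, Ω_b)` is a wall crossing structure near `b₀`, as far as the cone of `γ, γ'` is
concerned: the clockwise product `𝕊(Δ)_b` over the rays of the cone is the same for
all `b` near `b₀` for which the rays of `γ` and `γ'` span a nondegenerate strict sector. -/
def IsWCSNear {B : Type*} [TopologicalSpace B] (Z : B → Charge →+ ℂ) (Ω : B → Charge → ℚ)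
    (γ γ' : Charge) (b₀ : B) : Prop :=
  ∃ U ∈ 𝓝 b₀, ∀ N : ℕ, ∃ S : Module.End ℚ (Trunc N), ∀ b ∈ U, turn (Z b) γ γ' ≠ 0 →
    IsOrderedProduct (clockwise (Z b) γ γ') γ γ' (Ω b) N S

/-- The leading weak-coupling central charge `Z(γ) = C (a · g)`, dominated by the magnetic
charge. -/
def weakCentralCharge (C : ℂ) (a : Fin 2 → ℂ) : Charge →+ ℂ where
  toFun γ := C * ∑ i, (γ.1 i : ℂ) * a i
  map_zero' := by simp
  map_add' x y := by simp [Fin.sum_univ_two]; ring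

end SU3

end

/-!
The truncated group of a cone acts faithfully on `𝔤[t]/(t^{N+1})`, and the wall crossing formula is
an identity of operators there. Three facts about it carry the proof.

*Solutions exist* (`SU3.exists_kswcf`). The invariants on the other side are found degree by degree.
If the two ordered products agree in degree `≤ N`, they differ in degree `N + 1` by an element of
the Lie algebra of the cone (`SU3.exists_sub_eq_sum`), and this element is absorbed by the
invariants of degree `N + 1`, which enter both products linearly in that degree. That the difference
lies in the Lie algebra is seen without the Baker-Campbell-Hausdorff formula: the logarithmic
derivative `T⁻¹ (t d/dt) T` of a product of exponentials lies in the Lie algebra, and the one of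
`1 + t^{N+1} D` is `(N + 1) t^{N+1} D`.

*The dyons of `SU(2)`* (`SU3.KSWCF.apply_dyon`). Let only `γ, γ'` with `⟨γ,γ'⟩ = -2` be occupied on
the first side. Give `e_ρ` the level `-⟨γ+γ',ρ⟩`. On the other side the rays with `m < l` raise the
level, the ray `m = l` preserves it, and the rays `m > l` lower it, so the formula is a Gauss
decomposition `𝒦_γ 𝒦_γ' = U₊ U₀ U₋`. In the form `U₊⁻¹ 𝒦_γ 𝒦_γ' = U₀ U₋`, where `𝒦_γ` and `𝒦_γ'` act
on suitable `e_μ` by binomials `e_μ + t e_{μ+γ}`, two of its matrix coefficients express the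
invariant of `k γ + (k+1) γ'` by the `k`-th and by the `(k+1)`-st coefficient of the action of `U₀`
on `e_μ`. The resulting recursion makes all these invariants equal to `1`, without the invariants on
the ray `m = l` being needed. The charges `γ₁, γ₂, γ₃` are such dyons in the three cones of the
vanishing cycles, and these cones meet only in `0`, so that solutions can be glued.

*The primitive wall crossing* (`SU3.KSWCF.apply_add`). In degree two the formula says that
`Ω(γ+γ')` jumps by `(-1)^⟨γ,γ'⟩ ⟨γ,γ'⟩ Ω(γ) Ω(γ')`. As `⟨γ₁,γ₂⟩ = -1`, the jump of
`Ω(γ₃)` is `Ω(γ₁) Ω(γ₂)`, which takes `0` to `1` if only `γ₁, γ₂` are occupied, and `1` to `2` if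
`Ω(γ₁) = Ω(γ₂) = Ω(γ₃) = 1`.

For a family of central charges, the clockwise order of the rays is that of decreasing or increasing
slope according to the sign of `Im (Z(γ₁) / Z(γ₂))`, so the constancy of the clockwise product is
the wall crossing formula between any two nearby points on the two sides.
-/

noncomputable section

namespace SU3

/-! ### Operators on the truncated current algebra -/

/-- Shortcut instance: the search for it through the instances on linear maps fails. -/
instance instAddCommGroupEndTrunc (N : ℕ) : AddCommGroup (Module.End ℚ (Trunc N)) :=
  Ring.toAddCommGroup

/-- The coefficient of `e_ρ` of an element of `𝔤`. -/
def coef (ρ : Charge) : TorusLie →ₗ[ℚ] ℚ := Finsupp.lapply ρ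

theorem TorusLie.ext_coef {x y : TorusLie} (h : ∀ ρ, coef ρ x = coef ρ y) : x = y :=
  Finsupp.ext h

theorem coef_e (ρ ν : Charge) : coef ρ (e ν) = if ν = ρ then 1 else 0 :=
  Finsupp.single_apply

theorem lie_e (γ μ : Charge) : ⁅e γ, e μ⁆ = coeff γ μ • e (γ + μ) := bracketHom_e γ μ

theorem coef_lie_e (c ρ : Charge) (x : TorusLie) :
    coef ρ ⁅e c, x⁆ = coeff c (ρ - c) * coef (ρ - c) x := by
  induction x using TorusLie.induction with
  | h0 => simp
  | hadd x y hx hy => rw [lie_add, map_add, map_add, hx, hy]; ring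
  | he a ν =>
    rw [lie_smul, lie_e, map_smul, map_smul, map_smul, coef_e, coef_e]
    by_cases h : c + ν = ρ
    · have h2 : ν = ρ - c := by rw [← h]; abel
      rw [if_pos h, if_pos h2, ← h2]; simp [mul_comm]
    · have h2 : ¬ ν = ρ - c := fun h2 => h (by rw [h2]; abel)
      rw [if_neg h, if_neg h2]; simp

theorem pairing_nsmul_left (k : ℕ) (a b : Charge) : pairing (k • a) b = k * pairing a b := by
  simp [pairing, Fin.sum_univ_two]; ring

theorem pairing_nsmul_right (k : ℕ) (a b : Charge) : pairing a (k • b) = k * pairing a b := by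
  simp [pairing, Fin.sum_univ_two]; ring

theorem tMul_apply (N d : ℕ) (A : Module.End ℚ TorusLie) (f : Trunc N) (j : Fin (N + 1)) :
    tMul N d A f j = if d ≤ (j : ℕ) then A (f ⟨(j : ℕ) - d, by omega⟩) else 0 := rfl

theorem tMul_mul (N d d' : ℕ) (A B : Module.End ℚ TorusLie) :
    tMul N d A * tMul N d' B = tMul N (d + d') (A * B) := by
  refine LinearMap.ext fun f => funext fun j => ?_
  simp only [Module.End.mul_apply, tMul_apply]
  by_cases h : d ≤ (j : ℕ)
  · by_cases h' : d' ≤ (j : ℕ) - d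
    · rw [if_pos h, if_pos h', if_pos (by omega)]
      simp only [Nat.sub_sub]
    · rw [if_pos h, if_neg h', if_neg (by omega), map_zero]
  · rw [if_neg h, if_neg (by omega)]

theorem tMul_of_lt {N d : ℕ} (h : N < d) (A : Module.End ℚ TorusLie) : tMul N d A = 0 := by
  refine LinearMap.ext fun f => funext fun j => ?_
  rw [tMul_apply, if_neg (by omega)]
  rfl

theorem tMul_add (N d : ℕ) (A B : Module.End ℚ TorusLie) :
    tMul N d (A + B) = tMul N d A + tMul N d B := by
  refine LinearMap.ext fun f => funext fun j => ?_
  simp only [LinearMap.add_apply, Pi.add_apply, tMul_apply]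
  split_ifs <;> simp

theorem tMul_smul (N d : ℕ) (c : ℚ) (A : Module.End ℚ TorusLie) :
    tMul N d (c • A) = c • tMul N d A := by
  refine LinearMap.ext fun f => funext fun j => ?_
  simp only [LinearMap.smul_apply, Pi.smul_apply, tMul_apply]
  split_ifs <;> simp

theorem tMul_sub (N d : ℕ) (A B : Module.End ℚ TorusLie) :
    tMul N d (A - B) = tMul N d A - tMul N d B := by
  refine LinearMap.ext fun f => funext fun j => ?_
  simp only [LinearMap.sub_apply, Pi.sub_apply, tMul_apply]
  split_ifs <;> simp

/-- The operator `t^d [e_c, ·]`. -/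
abbrev tAd (N d : ℕ) (c : Charge) : Module.End ℚ (Trunc N) :=
  tMul N d (LieAlgebra.ad ℚ TorusLie (e c))

theorem ad_e_commutator (a b : Charge) :
    LieAlgebra.ad ℚ TorusLie (e a) * LieAlgebra.ad ℚ TorusLie (e b) -
      LieAlgebra.ad ℚ TorusLie (e b) * LieAlgebra.ad ℚ TorusLie (e a) =
        coeff a b • LieAlgebra.ad ℚ TorusLie (e (a + b)) := by
  refine LinearMap.ext fun x => ?_
  simp only [LinearMap.sub_apply, Module.End.mul_apply, LinearMap.smul_apply, LieAlgebra.ad_apply]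
  rw [leibniz_lie (e a) (e b) x, add_sub_cancel_right, lie_e, smul_lie]

theorem tAd_commutator (N d d' : ℕ) (a b : Charge) :
    tAd N d a * tAd N d' b - tAd N d' b * tAd N d a = coeff a b • tAd N (d + d') (a + b) := by
  rw [tMul_mul, tMul_mul, add_comm d' d, ← tMul_sub, ad_e_commutator, tMul_smul]

theorem coeff_nsmul_nsmul (k l : ℕ) (c : Charge) : coeff (k • c) (l • c) = 0 := by
  rw [coeff, pairing_nsmul_left, pairing_nsmul_right, pairing_self]
  simp

theorem tAd_nsmul_commute (N d d' k l : ℕ) (c : Charge) :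
    Commute (tAd N d (k • c)) (tAd N d' (l • c)) := by
  have h := tAd_commutator N d d' (k • c) (l • c)
  rw [coeff_nsmul_nsmul, zero_smul] at h
  exact sub_eq_zero.mp h

/-- The element `t^i e_ν` of the truncated current algebra (zero for `i > N`). -/
def monomial (N i : ℕ) (ν : Charge) : Trunc N := fun j => if (j : ℕ) = i then e ν else 0

theorem tAd_monomial (N d i : ℕ) (c ν : Charge) :
    tAd N d c (monomial N i ν) = coeff c ν • monomial N (i + d) (ν + c) := by
  funext j
  rw [tMul_apply, Pi.smul_apply]
  simp only [monomial, LieAlgebra.ad_apply]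
  by_cases h : (j : ℕ) = i + d
  · rw [if_pos (by omega), if_pos (by omega), if_pos h, lie_e, add_comm c ν]
  · rw [if_neg h, smul_zero]
    split_ifs <;> first | rfl | omega | simp

theorem monomial_of_lt {N i : ℕ} (h : N < i) (ν : Charge) : monomial N i ν = 0 := by
  funext j
  simp only [monomial, Pi.zero_apply]
  rw [if_neg (by omega)]

theorem coef_monomial (N i : ℕ) (ν ρ : Charge) (j : Fin (N + 1)) :
    coef ρ (monomial N i ν j) = if (j : ℕ) = i ∧ ν = ρ then 1 else 0 := by
  unfold monomial
  by_cases h : (j : ℕ) = i <;> simp [h, coef_e]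

/-! ### Filtrations by a weight -/

/-- The elements of the truncated current algebra all of whose terms `t^j e_ρ` have weight
`u j + wt ρ ≥ a`. With `u = 1`, `wt = 0` this is the filtration by the degree in `t`, with `u = 0`
that by a weight of the charges. -/
def filt (N : ℕ) (u : ℤ) (wt : Charge →+ ℤ) (a : ℤ) : Submodule ℚ (Trunc N) where
  carrier := {f | ∀ (j : Fin (N + 1)) (ρ : Charge), u * (j : ℕ) + wt ρ < a → coef ρ (f j) = 0}
  zero_mem' := by intro j ρ _; simp
  add_mem' := by
    intro f g hf hg j ρ h
    rw [Pi.add_apply, map_add, hf j ρ h, hg j ρ h, add_zero]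
  smul_mem' := by
    intro c f hf j ρ h
    rw [Pi.smul_apply, map_smul, hf j ρ h, smul_zero]

theorem filt_antitone {N : ℕ} {u : ℤ} {wt : Charge →+ ℤ} {a b : ℤ} (h : a ≤ b) :
    filt N u wt b ≤ filt N u wt a := fun _ hf j ρ hj => hf j ρ (lt_of_lt_of_le hj h)

theorem monomial_mem_filt (N : ℕ) (u : ℤ) (wt : Charge →+ ℤ) (i : ℕ) (ν : Charge) :
    monomial N i ν ∈ filt N u wt (u * i + wt ν) := by
  intro j ρ h
  rw [coef_monomial, if_neg]
  rintro ⟨h1, h2⟩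
  rw [h1, h2] at h
  exact lt_irrefl _ h

/-- The operators raising the weight `u j + wt ρ` of a term `t^j e_ρ` by at least `k`. -/
def raising (N : ℕ) (u : ℤ) (wt : Charge →+ ℤ) (k : ℤ) : Submodule ℚ (Module.End ℚ (Trunc N)) where
  carrier := {A | ∀ (a : ℤ) (f : Trunc N), f ∈ filt N u wt a → A f ∈ filt N u wt (a + k)}
  zero_mem' := fun a _ _ => (filt N u wt (a + k)).zero_mem
  add_mem' := fun hA hB a f hf => Submodule.add_mem _ (hA a f hf) (hB a f hf)
  smul_mem' := fun c _ hA a f hf => Submodule.smul_mem _ c (hA a f hf)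

section raising

variable {N : ℕ} {u : ℤ} {wt : Charge →+ ℤ}

theorem mul_mem_raising {k l : ℤ} {A B : Module.End ℚ (Trunc N)}
    (hA : A ∈ raising N u wt k) (hB : B ∈ raising N u wt l) : A * B ∈ raising N u wt (k + l) := by
  intro a f hf
  have := hA _ _ (hB a f hf)
  rwa [add_assoc, add_comm l k] at this

theorem one_mem_raising : (1 : Module.End ℚ (Trunc N)) ∈ raising N u wt 0 := by
  intro a f hf
  rwa [add_zero]

theorem raising_antitone {k l : ℤ} (h : k ≤ l) : raising N u wt l ≤ raising N u wt k :=
  fun _ hA a f hf => filt_antitone (by linarith) (hA a f hf)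

theorem pow_mem_raising {k : ℤ} {A : Module.End ℚ (Trunc N)} (hA : A ∈ raising N u wt k) (n : ℕ) :
    A ^ n ∈ raising N u wt (n * k) := by
  induction n with
  | zero => simpa using one_mem_raising
  | succ n ih =>
    rw [pow_succ, Nat.cast_succ, add_one_mul]
    exact mul_mem_raising ih hA

theorem tAd_mem_raising (d : ℕ) (c : Charge) : tAd N d c ∈ raising N u wt (u * d + wt c) := by
  intro a f hf j ρ h
  rw [tMul_apply]
  split_ifs with hd
  · rw [LieAlgebra.ad_apply, coef_lie_e, hf, mul_zero]
    rw [map_sub]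
    push_cast [Nat.cast_sub hd]
    linarith
  · simp

theorem ksLog_mem_raising (d : ℕ) (c : Charge) {k : ℤ} (hk : 0 ≤ k) (h : k ≤ u * d + wt c) :
    ksLog N d c ∈ raising N u wt k := by
  refine Submodule.sum_mem _ fun i hi => Submodule.smul_mem _ _ ?_
  refine raising_antitone ?_ (tAd_mem_raising _ _)
  have hi1 : (1 : ℤ) ≤ i := by exact_mod_cast (Finset.mem_Icc.mp hi).1
  rw [map_nsmul]
  push_cast
  have : u * (i * d) + i • wt c = i * (u * d + wt c) := by
    rw [nsmul_eq_mul]; ring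
  rw [this]
  nlinarith

theorem exp_sub_one_mem_raising {k : ℤ} (hk : 0 ≤ k) {A : Module.End ℚ (Trunc N)}
    (hA : A ∈ raising N u wt k) (hn : IsNilpotent A) :
    IsNilpotent.exp A - 1 ∈ raising N u wt k := by
  obtain ⟨n, hn⟩ := hn
  rw [IsNilpotent.exp_eq_sum (k := n + 1) (by rw [pow_succ, hn, zero_mul]), Finset.sum_range_succ']
  simp only [pow_zero, Nat.factorial_zero, Nat.cast_one, inv_one, one_smul, add_sub_cancel_right]
  refine Submodule.sum_mem _ fun i _ => Submodule.smul_mem _ _ ?_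
  refine raising_antitone ?_ (pow_mem_raising hA (i + 1))
  push_cast
  nlinarith [mul_nonneg (Nat.cast_nonneg (α := ℤ) i) hk]

theorem exp_sub_one_sub_mem_raising {k : ℤ} (hk : 0 ≤ k) {A : Module.End ℚ (Trunc N)}
    (hA : A ∈ raising N u wt k) (hn : IsNilpotent A) :
    IsNilpotent.exp A - 1 - A ∈ raising N u wt (2 * k) := by
  obtain ⟨n, hn⟩ := hn
  rw [IsNilpotent.exp_eq_sum (k := n + 2) (by rw [pow_add, hn, zero_mul]), Finset.sum_range_succ',
    Finset.sum_range_succ']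
  simp only [pow_zero, Nat.factorial_zero, Nat.cast_one, inv_one, one_smul, add_sub_cancel_right,
    zero_add, Nat.factorial_one, pow_one]
  refine Submodule.sum_mem _ fun i _ => Submodule.smul_mem _ _ ?_
  refine raising_antitone ?_ (pow_mem_raising hA (i + 1 + 1))
  push_cast
  nlinarith [mul_nonneg (Nat.cast_nonneg (α := ℤ) i) hk]

end raising

/-- The operators raising the degree in `t` by at least `k`. -/
abbrev tOrder (N : ℕ) (k : ℤ) : Submodule ℚ (Module.End ℚ (Trunc N)) := raising N 1 0 k

theorem eq_zero_of_mem_tOrder {N : ℕ} {k : ℤ} (hk : N < k) {A : Module.End ℚ (Trunc N)}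
    (hA : A ∈ tOrder N k) : A = 0 := by
  refine LinearMap.ext fun f => funext fun j => TorusLie.ext_coef fun ρ => ?_
  have h0 : f ∈ filt N 1 0 0 := by
    intro j ρ h
    simp only [one_mul, AddMonoidHom.zero_apply, add_zero] at h
    omega
  have := hA 0 f h0 j ρ (by simp only [one_mul, AddMonoidHom.zero_apply]; omega)
  rw [this]
  simp

theorem isNilpotent_of_mem_tOrder {N : ℕ} {A : Module.End ℚ (Trunc N)} (hA : A ∈ tOrder N 1) :
    IsNilpotent A :=
  ⟨N + 1, eq_zero_of_mem_tOrder (k := (N + 1 : ℕ) * 1) (by push_cast; linarith)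
    (pow_mem_raising hA (N + 1))⟩

theorem tAd_mem_tOrder (N d : ℕ) (c : Charge) : tAd N d c ∈ tOrder N d := by
  simpa using tAd_mem_raising (N := N) (u := 1) (wt := 0) d c

theorem ksLog_mem_tOrder (N d : ℕ) (c : Charge) : ksLog N d c ∈ tOrder N d :=
  ksLog_mem_raising d c (by positivity) (by simp)

theorem isNilpotent_smul_ksLog (N : ℕ) {d : ℕ} (hd : 1 ≤ d) (γ : Charge) (c : ℚ) :
    IsNilpotent (c • ksLog N d γ) :=
  isNilpotent_of_mem_tOrder
    (Submodule.smul_mem _ c (raising_antitone (by exact_mod_cast hd) (ksLog_mem_tOrder N d γ)))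

theorem ksPow_zero (N d : ℕ) (γ : Charge) : ksPow N d γ 0 = 1 := by
  rw [ksPow, zero_smul, IsNilpotent.exp_zero]

theorem ksPow_mul_neg (N : ℕ) {d : ℕ} (hd : 1 ≤ d) (γ : Charge) (c : ℚ) :
    ksPow N d γ c * ksPow N d γ (-c) = 1 := by
  rw [ksPow, ksPow, neg_smul]
  exact IsNilpotent.exp_mul_exp_neg_self (isNilpotent_smul_ksLog N hd γ c)

theorem ksPow_neg_mul (N : ℕ) {d : ℕ} (hd : 1 ≤ d) (γ : Charge) (c : ℚ) :
    ksPow N d γ (-c) * ksPow N d γ c = 1 := by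
  have := ksPow_mul_neg N hd γ (-c)
  rwa [neg_neg] at this

theorem ksPow_sub_one_mem_raising {N : ℕ} {u : ℤ} {wt : Charge →+ ℤ} {d : ℕ} (hd : 1 ≤ d)
    (γ : Charge) (c : ℚ) {k : ℤ} (hk : 0 ≤ k) (h : k ≤ u * d + wt γ) :
    ksPow N d γ c - 1 ∈ raising N u wt k :=
  exp_sub_one_mem_raising hk (Submodule.smul_mem _ c (ksLog_mem_raising d γ hk h))
    (isNilpotent_smul_ksLog N hd γ c)

theorem mul_sub_one_eq {R : Type*} [Ring R] (a b : R) :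
    a * b - 1 = (a - 1) * (b - 1) + (a - 1) + (b - 1) := by
  rw [sub_mul, mul_sub, one_mul, mul_one]
  abel

/-- Products of operators that are `1` modulo an ideal of raising operators stay so. -/
theorem mul_sub_one_mem_raising {N : ℕ} {u : ℤ} {wt : Charge →+ ℤ} {k : ℤ} (hk : 0 ≤ k)
    {A B : Module.End ℚ (Trunc N)} (hA : A - 1 ∈ raising N u wt k) (hB : B - 1 ∈ raising N u wt k) :
    A * B - 1 ∈ raising N u wt k := by
  rw [mul_sub_one_eq]
  refine Submodule.add_mem _ (Submodule.add_mem _ ?_ hA) hB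
  exact raising_antitone (by linarith) (mul_mem_raising hA hB)

theorem list_prod_sub_one_mem_raising {N : ℕ} {u : ℤ} {wt : Charge →+ ℤ} {k : ℤ} (hk : 0 ≤ k)
    (L : List (Module.End ℚ (Trunc N))) (h : ∀ A ∈ L, A - 1 ∈ raising N u wt k) :
    L.prod - 1 ∈ raising N u wt k := by
  induction L with
  | nil => simp
  | cons A L ih =>
    rw [List.prod_cons]
    exact mul_sub_one_mem_raising hk (h A (by simp)) (ih fun B hB => h B (by simp [hB]))

/-! ### Ordered lists of rays -/

theorem IsOrderedRays.nodup {N : ℕ} {L : List (ℕ × ℕ)} (h : IsOrderedRays fromFirst N L) :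
    L.Nodup :=
  List.Pairwise.imp (fun hab => fun hEq => by
    rw [hEq] at hab
    exact lt_irrefl _ hab) h.2

theorem IsOrderedRays.unique {N : ℕ} {L L' : List (ℕ × ℕ)} (h : IsOrderedRays fromFirst N L)
    (h' : IsOrderedRays fromFirst N L') : L = L' :=
  ((List.perm_ext_iff_of_nodup h.nodup h'.nodup).2 fun p => by rw [h.1, h'.1]).eq_of_pairwise
    (fun _ _ _ _ hab hba => absurd hab (lt_asymm hba)) h.2 h'.2

theorem isOrderedRays_reverse {N : ℕ} {L : List (ℕ × ℕ)} :
    IsOrderedRays fromSecond N L ↔ IsOrderedRays fromFirst N L.reverse := by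
  simp only [IsOrderedRays, List.mem_reverse, List.pairwise_reverse]
  rfl

/-- The slope `m / (m + l)` of a ray: the order `fromFirst` is that of decreasing slope. -/
def slope (p : ℕ × ℕ) : ℚ := p.1 / (p.1 + p.2)

theorem fromFirst_of_slope_le {p q : ℕ × ℕ} (hp : Nat.Coprime p.1 p.2) (hq : Nat.Coprime q.1 q.2)
    (hne : p ≠ q) (h : slope q ≤ slope p) : fromFirst p q := by
  obtain ⟨m, l⟩ := p
  obtain ⟨m', l'⟩ := q
  simp only [fromFirst, slope] at *
  have h1 : 0 < m + l := by
    rcases Nat.eq_zero_or_pos (m + l) with h0 | h0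
    · obtain ⟨rfl, rfl⟩ : m = 0 ∧ l = 0 := by omega
      simp at hp
    · exact h0
  have h2 : 0 < m' + l' := by
    rcases Nat.eq_zero_or_pos (m' + l') with h0 | h0
    · obtain ⟨rfl, rfl⟩ : m' = 0 ∧ l' = 0 := by omega
      simp at hq
    · exact h0
  have h1' : (0 : ℚ) < m + l := by exact_mod_cast h1
  have h2' : (0 : ℚ) < m' + l' := by exact_mod_cast h2
  rw [div_le_div_iff₀ h2' h1'] at h
  have h3 : m' * (m + l) ≤ m * (m' + l') := by exact_mod_cast h
  have h4 : m' * l ≤ m * l' := by nlinarith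
  refine lt_of_le_of_ne h4 fun h5 => hne ?_
  have e1 : m ∣ m' := hp.dvd_of_dvd_mul_right (h5 ▸ Dvd.intro _ rfl)
  have e2 : m' ∣ m := hq.dvd_of_dvd_mul_right (h5 ▸ Dvd.intro _ rfl)
  have e3 : l ∣ l' := hp.symm.dvd_of_dvd_mul_left (h5 ▸ Dvd.intro_left _ rfl)
  have e4 : l' ∣ l := hq.symm.dvd_of_dvd_mul_left (h5 ▸ Dvd.intro_left _ rfl)
  rw [Nat.dvd_antisymm e1 e2, Nat.dvd_antisymm e3 e4]

theorem exists_isOrderedRays (N : ℕ) : ∃ L, IsOrderedRays fromFirst N L := by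
  classical
  let F : Finset (ℕ × ℕ) := (Finset.range (N + 1) ×ˢ Finset.range (N + 1)).filter
    fun p => Nat.Coprime p.1 p.2 ∧ p.1 + p.2 ≤ N
  have hF : ∀ p, p ∈ F ↔ Nat.Coprime p.1 p.2 ∧ p.1 + p.2 ≤ N := by
    intro p
    simp only [F, Finset.mem_filter, Finset.mem_product, Finset.mem_range, and_iff_right_iff_imp]
    intro h
    omega
  let L := F.toList.mergeSort fun p q => decide (slope q ≤ slope p)
  have hperm : L.Perm F.toList := List.mergeSort_perm _ _
  have hmem : ∀ p, p ∈ L ↔ Nat.Coprime p.1 p.2 ∧ p.1 + p.2 ≤ N := fun p => by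
    rw [hperm.mem_iff, Finset.mem_toList, hF]
  have hnd : L.Nodup := hperm.nodup_iff.2 F.nodup_toList
  have hs : L.Pairwise fun p q => decide (slope q ≤ slope p) = true := by
    refine List.pairwise_mergeSort ?_ ?_ _
    · intro a b c h1 h2
      simp only [decide_eq_true_eq] at *
      exact h2.trans h1
    · intro a b
      simp only [Bool.or_eq_true, decide_eq_true_eq]
      exact le_total _ _
  refine ⟨L, hmem, ?_⟩
  refine (hs.and hnd).imp_of_mem ?_
  intro p q hp hq h
  exact fromFirst_of_slope_le ((hmem p).1 hp).1 ((hmem q).1 hq).1 h.2 (by simpa using h.1)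

/-- The list of the rays visible in degree `≤ N`, from `γ = (1, 0)` to `γ' = (0, 1)`. -/
def rayList (N : ℕ) : List (ℕ × ℕ) := (exists_isOrderedRays N).choose

theorem isOrderedRays_rayList (N : ℕ) : IsOrderedRays fromFirst N (rayList N) :=
  (exists_isOrderedRays N).choose_spec

theorem mem_rayList {N : ℕ} {p : ℕ × ℕ} :
    p ∈ rayList N ↔ Nat.Coprime p.1 p.2 ∧ p.1 + p.2 ≤ N := (isOrderedRays_rayList N).1 p

theorem nodup_rayList (N : ℕ) : (rayList N).Nodup := (isOrderedRays_rayList N).nodup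

theorem one_le_of_coprime {p : ℕ × ℕ} (h : Nat.Coprime p.1 p.2) : 1 ≤ p.1 + p.2 := by
  by_contra h0
  have h1 : p.1 = 0 ∧ p.2 = 0 := by omega
  rw [h1.1, h1.2] at h
  simp at h

theorem one_le_of_mem_rayList {N : ℕ} {p : ℕ × ℕ} (h : p ∈ rayList N) : 1 ≤ p.1 + p.2 :=
  one_le_of_coprime (mem_rayList.1 h).1

theorem isOrderedProduct_fromFirst_iff {γ γ' : Charge} {Ω : Charge → ℚ} {N : ℕ}
    {S : Module.End ℚ (Trunc N)} :
    IsOrderedProduct fromFirst γ γ' Ω N S ↔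
      S = ((rayList N).map (rayElement N γ γ' Ω)).prod := by
  constructor
  · rintro ⟨L, hL, rfl⟩
    rw [hL.unique (isOrderedRays_rayList N)]
  · exact fun h => ⟨rayList N, isOrderedRays_rayList N, h⟩

theorem isOrderedProduct_fromSecond_iff {γ γ' : Charge} {Ω : Charge → ℚ} {N : ℕ}
    {S : Module.End ℚ (Trunc N)} :
    IsOrderedProduct fromSecond γ γ' Ω N S ↔
      S = ((rayList N).reverse.map (rayElement N γ γ' Ω)).prod := by
  constructor
  · rintro ⟨L, hL, rfl⟩
    rw [← (isOrderedRays_reverse.1 hL).unique (isOrderedRays_rayList N), List.reverse_reverse]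
  · refine fun h => ⟨(rayList N).reverse, ?_, h⟩
    rw [isOrderedRays_reverse, List.reverse_reverse]
    exact isOrderedRays_rayList N

theorem kswcf_iff {γ γ' : Charge} {Ω Ω' : Charge → ℚ} :
    KSWCF γ γ' Ω Ω' ↔ ∀ N, ((rayList N).map (rayElement N γ γ' Ω)).prod =
      ((rayList N).reverse.map (rayElement N γ γ' Ω')).prod := by
  simp only [KSWCF, isOrderedProduct_fromFirst_iff, isOrderedProduct_fromSecond_iff,
    exists_eq_left]

/-! ### Elementary properties of the ray elements -/

theorem ksLog_of_lt {N d : ℕ} (h : N < d) (γ : Charge) : ksLog N d γ = 0 := by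
  refine Finset.sum_eq_zero fun k hk => ?_
  have hk1 := (Finset.mem_Icc.1 hk).1
  rw [tMul_of_lt (by nlinarith), smul_zero]

theorem ksPow_of_lt {N d : ℕ} (h : N < d) (γ : Charge) (c : ℚ) : ksPow N d γ c = 1 := by
  rw [ksPow, ksLog_of_lt h, smul_zero, IsNilpotent.exp_zero]

theorem succ_nsmul_ray (i : ℕ) (p : ℕ × ℕ) (γ γ' : Charge) :
    (i + 1) • (p.1 • γ + p.2 • γ') = ((i + 1) * p.1) • γ + ((i + 1) * p.2) • γ' := by
  rw [smul_add, mul_smul, mul_smul]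

theorem rayElement_congr {N : ℕ} {γ γ' : Charge} {Ω Ω' : Charge → ℚ}
    (h : ∀ m l : ℕ, 1 ≤ m + l → m + l ≤ N → Ω (m • γ + l • γ') = Ω' (m • γ + l • γ'))
    {p : ℕ × ℕ} (hp : 1 ≤ p.1 + p.2) : rayElement N γ γ' Ω p = rayElement N γ γ' Ω' p := by
  unfold rayElement
  congr 1
  refine List.map_congr_left fun i _ => ?_
  rcases lt_or_ge N ((i + 1) * (p.1 + p.2)) with h1 | h1
  · rw [ksPow_of_lt h1, ksPow_of_lt h1]
  · rw [succ_nsmul_ray, h]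
    · rw [← mul_add]
      exact Nat.mul_pos (Nat.succ_pos i) hp
    · rw [← mul_add]
      exact h1

theorem rayElement_sub_one_mem_raising {N : ℕ} {u : ℤ} {wt : Charge →+ ℤ} {γ γ' : Charge}
    {Ω : Charge → ℚ} {p : ℕ × ℕ} (hp : 1 ≤ p.1 + p.2) {k : ℤ} (hk : 0 ≤ k)
    (h : k ≤ u * ((p.1 + p.2 : ℕ) : ℤ) + wt (p.1 • γ + p.2 • γ')) :
    rayElement N γ γ' Ω p - 1 ∈ raising N u wt k := by
  refine list_prod_sub_one_mem_raising hk _ fun A hA => ?_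
  obtain ⟨i, _, rfl⟩ := List.mem_map.1 hA
  refine ksPow_sub_one_mem_raising (Nat.mul_pos (Nat.succ_pos i) hp) _ _ hk ?_
  rw [map_nsmul, nsmul_eq_mul]
  push_cast at h ⊢
  nlinarith [mul_nonneg (Nat.cast_nonneg (α := ℤ) i) (hk.trans h)]

theorem rayElement_sub_one_mem_tOrder {N : ℕ} {γ γ' : Charge} {Ω : Charge → ℚ} {p : ℕ × ℕ}
    (hp : 1 ≤ p.1 + p.2) : rayElement N γ γ' Ω p - 1 ∈ tOrder N 1 :=
  rayElement_sub_one_mem_raising hp zero_le_one (by simp; exact_mod_cast hp)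

theorem rayElement_of_lt {N : ℕ} {γ γ' : Charge} {Ω : Charge → ℚ} {p : ℕ × ℕ}
    (hp : N < p.1 + p.2) : rayElement N γ γ' Ω p = 1 := by
  refine List.prod_eq_one fun A hA => ?_
  obtain ⟨i, _, rfl⟩ := List.mem_map.1 hA
  exact ksPow_of_lt (lt_of_lt_of_le hp (Nat.le_mul_of_pos_left _ (Nat.succ_pos i))) _ _

theorem list_prod_filter_of_eq_one {M ι : Type*} [Monoid M] (f : ι → M) (P : ι → Bool)
    (L : List ι) (h : ∀ i ∈ L, P i = false → f i = 1) :
    ((L.filter P).map f).prod = (L.map f).prod := by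
  induction L with
  | nil => rfl
  | cons a L ih =>
    have ih' := ih fun i hi => h i (by simp [hi])
    cases hP : P a with
    | false => rw [List.filter_cons_of_neg (by simp [hP]), ih', List.map_cons, List.prod_cons,
        h a (by simp) hP, one_mul]
    | true => rw [List.filter_cons_of_pos hP, List.map_cons, List.map_cons, List.prod_cons,
        List.prod_cons, ih']

/-! ### Change of the truncation -/

/-- The projection `𝔤[t]/(t^{N+2}) → 𝔤[t]/(t^{N+1})`. -/
def truncate (N : ℕ) : Trunc (N + 1) →ₗ[ℚ] Trunc N where
  toFun f j := f j.castSucc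
  map_add' _ _ := rfl
  map_smul' _ _ := rfl

theorem truncate_comp_tMul (N d : ℕ) (A : Module.End ℚ TorusLie) :
    tMul N d A ∘ₗ truncate N = truncate N ∘ₗ tMul (N + 1) d A := by
  refine LinearMap.ext fun f => funext fun j => ?_
  simp only [LinearMap.comp_apply, tMul_apply, truncate, LinearMap.coe_mk, AddHom.coe_mk]
  rfl

theorem truncate_comp_ksLog (N : ℕ) {d : ℕ} (hd : 1 ≤ d) (γ : Charge) :
    ksLog N d γ ∘ₗ truncate N = truncate N ∘ₗ ksLog (N + 1) d γ := by
  unfold ksLog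
  rw [Finset.sum_Icc_succ_top (by omega)]
  have hz : (1 / ((N + 1 : ℕ) : ℚ) ^ 2) •
      tMul N ((N + 1) * d) (LieAlgebra.ad ℚ TorusLie (e ((N + 1) • γ))) = 0 := by
    rw [tMul_of_lt (by nlinarith), smul_zero]
  rw [← add_zero (∑ k ∈ Finset.Icc 1 N, _), ← hz]
  refine LinearMap.ext fun f => ?_
  have h : ∀ (e : ℕ) A, tMul N e A (truncate N f) = truncate N (tMul (N + 1) e A f) :=
    fun e A => LinearMap.congr_fun (truncate_comp_tMul N e A) f
  simp only [LinearMap.comp_apply, LinearMap.add_apply, LinearMap.sum_apply, LinearMap.smul_apply,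
    map_add, map_sum, map_smul, h]

theorem truncate_comp_ksPow (N : ℕ) {d : ℕ} (hd : 1 ≤ d) (γ : Charge) (c : ℚ) :
    ksPow N d γ c ∘ₗ truncate N = truncate N ∘ₗ ksPow (N + 1) d γ c := by
  refine Module.End.commute_exp_left_of_commute (isNilpotent_smul_ksLog _ hd _ _)
    (isNilpotent_smul_ksLog _ hd _ _) ?_
  rw [LinearMap.smul_comp, LinearMap.comp_smul, truncate_comp_ksLog N hd]

theorem truncate_comp_list_prod {N : ℕ} {ι : Type*} (f : ι → Module.End ℚ (Trunc N))
    (g : ι → Module.End ℚ (Trunc (N + 1))) (L : List ι)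
    (h : ∀ i ∈ L, f i ∘ₗ truncate N = truncate N ∘ₗ g i) :
    (L.map f).prod ∘ₗ truncate N = truncate N ∘ₗ (L.map g).prod := by
  induction L with
  | nil => rfl
  | cons a L ih =>
    have ih' := ih fun i hi => h i (by simp [hi])
    rw [List.map_cons, List.map_cons, List.prod_cons, List.prod_cons, Module.End.mul_eq_comp,
      Module.End.mul_eq_comp, LinearMap.comp_assoc, ih', ← LinearMap.comp_assoc, h a (by simp),
      LinearMap.comp_assoc]

theorem truncate_comp_rayElement (N : ℕ) (γ γ' : Charge) (Ω : Charge → ℚ) {p : ℕ × ℕ}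
    (hp : 1 ≤ p.1 + p.2) :
    rayElement N γ γ' Ω p ∘ₗ truncate N = truncate N ∘ₗ rayElement (N + 1) γ γ' Ω p := by
  have h1 : rayElement N γ γ' Ω p = ((List.range (N + 1)).map fun i =>
      ksPow N ((i + 1) * (p.1 + p.2)) ((i + 1) • (p.1 • γ + p.2 • γ'))
        (Ω ((i + 1) • (p.1 • γ + p.2 • γ')))).prod := by
    rw [List.range_succ, List.map_append, List.prod_append, List.map_singleton,
      List.prod_singleton, ksPow_of_lt (by nlinarith), mul_one]
    rfl
  rw [h1]
  exact truncate_comp_list_prod _ _ _ fun i _ =>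
    truncate_comp_ksPow N (Nat.mul_pos (Nat.succ_pos i) hp) _ _

theorem filter_rayList (N : ℕ) :
    (rayList (N + 1)).filter (fun p => decide (p.1 + p.2 ≤ N)) = rayList N := by
  refine IsOrderedRays.unique ⟨fun p => ?_, ?_⟩ (isOrderedRays_rayList N)
  · rw [List.mem_filter, mem_rayList, decide_eq_true_eq]
    constructor
    · exact fun h => ⟨h.1.1, h.2⟩
    · exact fun h => ⟨⟨h.1, by omega⟩, h.2⟩
  · exact (isOrderedRays_rayList (N + 1)).2.filter _

theorem truncate_comp_prod (N : ℕ) (γ γ' : Charge) (Ω : Charge → ℚ) :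
    ((rayList N).map (rayElement N γ γ' Ω)).prod ∘ₗ truncate N =
      truncate N ∘ₗ ((rayList (N + 1)).map (rayElement (N + 1) γ γ' Ω)).prod := by
  rw [← filter_rayList, list_prod_filter_of_eq_one]
  · exact truncate_comp_list_prod _ _ _ fun p hp =>
      truncate_comp_rayElement N γ γ' Ω (one_le_of_mem_rayList hp)
  · intro p _ h
    exact rayElement_of_lt (by simpa using h)

theorem truncate_comp_prod_reverse (N : ℕ) (γ γ' : Charge) (Ω : Charge → ℚ) :
    ((rayList N).reverse.map (rayElement N γ γ' Ω)).prod ∘ₗ truncate N =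
      truncate N ∘ₗ ((rayList (N + 1)).reverse.map (rayElement (N + 1) γ γ' Ω)).prod := by
  rw [← filter_rayList, ← List.filter_reverse, list_prod_filter_of_eq_one]
  · exact truncate_comp_list_prod _ _ _ fun p hp =>
      truncate_comp_rayElement N γ γ' Ω (one_le_of_mem_rayList (List.mem_reverse.1 hp))
  · intro p _ h
    exact rayElement_of_lt (by simpa using h)

/-! ### Conjugation by exponentials -/

theorem exp_mulRight {A : Type*} [Ring A] [Algebra ℚ A] {a : A} (ha : IsNilpotent a) :
    IsNilpotent.exp (LinearMap.mulRight ℚ a) = LinearMap.mulRight ℚ (IsNilpotent.exp a) := by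
  obtain ⟨k, hk⟩ := ha
  have hk' : LinearMap.mulRight ℚ a ^ k = 0 := by rw [LinearMap.pow_mulRight, hk]; ext; simp
  rw [IsNilpotent.exp_eq_sum hk, IsNilpotent.exp_eq_sum hk']
  refine LinearMap.ext fun x => ?_
  simp only [LinearMap.sum_apply, LinearMap.smul_apply, LinearMap.pow_mulRight,
    LinearMap.mulRight_apply, Finset.mul_sum, mul_smul_comm]

theorem exp_mulLeft {A : Type*} [Ring A] [Algebra ℚ A] {a : A} (ha : IsNilpotent a) :
    IsNilpotent.exp (LinearMap.mulLeft ℚ a) = LinearMap.mulLeft ℚ (IsNilpotent.exp a) :=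
  (IsNilpotent.map_exp ha (Algebra.lmul ℚ A)).symm

/-- `exp a · x · exp (-a) = exp ([a, ·]) x` lies in every subspace that contains `x` and is stable
under `[a, ·]`. -/
theorem exp_conj_mem {A : Type*} [Ring A] [Algebra ℚ A] {a : A} (ha : IsNilpotent a)
    (V : Submodule ℚ A) (hV : ∀ x ∈ V, a * x - x * a ∈ V) {x : A} (hx : x ∈ V) :
    IsNilpotent.exp a * x * IsNilpotent.exp (-a) ∈ V := by
  have hL : IsNilpotent (LinearMap.mulLeft ℚ a) := ha.map (Algebra.lmul ℚ A)
  have hR : IsNilpotent (LinearMap.mulRight ℚ (-a)) := by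
    obtain ⟨k, hk⟩ := ha.neg
    exact ⟨k, by rw [LinearMap.pow_mulRight, hk]; ext; simp⟩
  have hc : Commute (LinearMap.mulLeft ℚ a) (LinearMap.mulRight ℚ (-a)) :=
    LinearMap.commute_mulLeft_right a (-a)
  have h1 : IsNilpotent.exp a * x * IsNilpotent.exp (-a) =
      IsNilpotent.exp (LinearMap.mulLeft ℚ a + LinearMap.mulRight ℚ (-a)) x := by
    rw [IsNilpotent.exp_add_of_commute hc hL hR, exp_mulLeft ha, exp_mulRight ha.neg,
      Module.End.mul_apply, LinearMap.mulLeft_apply, LinearMap.mulRight_apply, mul_assoc]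
  have hpow : ∀ n : ℕ, ((LinearMap.mulLeft ℚ a + LinearMap.mulRight ℚ (-a)) ^ n) x ∈ V := by
    intro n
    induction n with
    | zero => simpa using hx
    | succ n ih =>
      rw [pow_succ', Module.End.mul_apply, LinearMap.add_apply, LinearMap.mulLeft_apply,
        LinearMap.mulRight_apply, mul_neg, ← sub_eq_add_neg]
      exact hV _ ih
  obtain ⟨k, hk⟩ := hc.isNilpotent_add hL hR
  rw [h1, IsNilpotent.exp_eq_sum hk, LinearMap.sum_apply]
  exact Submodule.sum_mem _ fun i _ => Submodule.smul_mem _ _ (hpow i)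

/-! ### The grading by the degree in `t` -/

/-- The Euler operator `t d/dt`. -/
def euler (N : ℕ) : Module.End ℚ (Trunc N) where
  toFun f j := ((j : ℕ) : ℚ) • f j
  map_add' f g := by funext j; simp
  map_smul' c f := by funext j; simp [smul_comm c]

theorem euler_apply (N : ℕ) (f : Trunc N) (j : Fin (N + 1)) :
    euler N f j = ((j : ℕ) : ℚ) • f j := rfl

/-- The derivation `[t d/dt, ·]` of the algebra of operators. -/
def delta (N : ℕ) : Module.End ℚ (Module.End ℚ (Trunc N)) where
  toFun A := euler N * A - A * euler N
  map_add' A B := by rw [mul_add, add_mul]; abel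
  map_smul' c A := by rw [mul_smul_comm, smul_mul_assoc, ← smul_sub, RingHom.id_apply]

theorem delta_apply (N : ℕ) (A : Module.End ℚ (Trunc N)) :
    delta N A = euler N * A - A * euler N := rfl

theorem delta_mul (N : ℕ) (A B : Module.End ℚ (Trunc N)) :
    delta N (A * B) = delta N A * B + A * delta N B := by
  simp only [delta_apply, sub_mul, mul_sub, mul_assoc]
  abel

theorem delta_one (N : ℕ) : delta N 1 = 0 := by
  rw [delta_apply, mul_one, one_mul, sub_self]

theorem delta_tMul (N d : ℕ) (A : Module.End ℚ TorusLie) :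
    delta N (tMul N d A) = (d : ℚ) • tMul N d A := by
  refine LinearMap.ext fun f => funext fun j => ?_
  simp only [delta_apply, LinearMap.sub_apply, Module.End.mul_apply, Pi.sub_apply, euler_apply,
    tMul_apply, LinearMap.smul_apply, Pi.smul_apply]
  by_cases h : d ≤ (j : ℕ)
  · rw [if_pos h, if_pos h, map_smul, ← sub_smul]
    congr 1
    rw [Nat.cast_sub h]
    ring
  · rw [if_neg h, if_neg h]
    simp

theorem delta_pow {N : ℕ} {A : Module.End ℚ (Trunc N)} (h : Commute A (delta N A)) (n : ℕ) :
    delta N (A ^ (n + 1)) = ((n + 1 : ℕ) : ℚ) • (A ^ n * delta N A) := by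
  induction n with
  | zero => simp
  | succ n ih =>
    rw [pow_succ, delta_mul, ih, smul_mul_assoc, mul_assoc, ← h.eq, ← mul_assoc, ← pow_succ]
    push_cast
    module

/-- The chain rule for the exponential of an operator that commutes with its derivative. -/
theorem delta_exp {N : ℕ} {A : Module.End ℚ (Trunc N)} (h : Commute A (delta N A))
    (hn : IsNilpotent A) :
    delta N (IsNilpotent.exp A) = IsNilpotent.exp A * delta N A := by
  obtain ⟨k, hk⟩ := hn
  have h1 : IsNilpotent.exp A =
      ∑ i ∈ Finset.range (k + 1), (i.factorial : ℚ)⁻¹ • A ^ i :=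
    IsNilpotent.exp_eq_sum (by rw [pow_succ, hk, zero_mul])
  have h2 : delta N (IsNilpotent.exp A) = delta N (∑ i ∈ Finset.range (k + 1),
      (i.factorial : ℚ)⁻¹ • A ^ i) := congr_arg _ h1
  rw [h2, Finset.sum_range_succ', map_add, map_sum, IsNilpotent.exp_eq_sum hk, Finset.sum_mul]
  simp only [pow_zero, map_smul, delta_one, smul_zero, add_zero]
  refine Finset.sum_congr rfl fun i _ => ?_
  rw [delta_pow h, smul_smul, smul_mul_assoc, Nat.factorial_succ]
  congr 1
  have : ((i + 1 : ℕ) : ℚ) ≠ 0 := by exact_mod_cast Nat.succ_ne_zero i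
  have h2 : (i.factorial : ℚ) ≠ 0 := by exact_mod_cast i.factorial_ne_zero
  push_cast at this ⊢
  field_simp

theorem commute_ksLog_delta (N d : ℕ) (γ : Charge) :
    Commute (ksLog N d γ) (delta N (ksLog N d γ)) := by
  unfold ksLog
  rw [map_sum]
  refine Commute.sum_left _ _ _ fun k _ => Commute.sum_right _ _ _ fun l _ => ?_
  rw [map_smul, delta_tMul]
  exact ((((tAd_nsmul_commute N _ _ k l γ).smul_right _).smul_right _).smul_left _)

theorem delta_ksPow (N : ℕ) {d : ℕ} (hd : 1 ≤ d) (γ : Charge) (c : ℚ) :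
    delta N (ksPow N d γ c) = ksPow N d γ c * (c • delta N (ksLog N d γ)) := by
  unfold ksPow
  rw [delta_exp, map_smul]
  · rw [map_smul]
    exact ((commute_ksLog_delta N d γ).smul_right c).smul_left c
  · exact isNilpotent_smul_ksLog N hd γ c

/-! ### The pro-nilpotent group of a cone -/

/-- The truncated Lie algebra of the cone, acting on the truncated current algebra. -/
def coneLie (N : ℕ) (γ γ' : Charge) : Submodule ℚ (Module.End ℚ (Trunc N)) :=
  Submodule.span ℚ {A | ∃ m l : ℕ, 1 ≤ m + l ∧ A = tAd N (m + l) (m • γ + l • γ')}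

section cone

variable {N : ℕ} {γ γ' : Charge}

theorem tAd_mem_coneLie {m l : ℕ} (h : 1 ≤ m + l) :
    tAd N (m + l) (m • γ + l • γ') ∈ coneLie N γ γ' :=
  Submodule.subset_span ⟨m, l, h, rfl⟩

theorem coneLie_le_tOrder : coneLie N γ γ' ≤ tOrder N 1 := by
  refine Submodule.span_le.2 ?_
  rintro _ ⟨m, l, h, rfl⟩
  exact raising_antitone (by exact_mod_cast h) (tAd_mem_tOrder N _ _)

theorem commutator_mem_coneLie {A B : Module.End ℚ (Trunc N)} (hA : A ∈ coneLie N γ γ')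
    (hB : B ∈ coneLie N γ γ') : A * B - B * A ∈ coneLie N γ γ' := by
  induction hA using Submodule.span_induction with
  | zero => simp
  | add x y _ _ hx hy =>
    have : (x + y) * B - B * (x + y) = (x * B - B * x) + (y * B - B * y) := by
      rw [add_mul, mul_add]; abel
    rw [this]
    exact Submodule.add_mem _ hx hy
  | smul c x _ hx =>
    rw [smul_mul_assoc, mul_smul_comm, ← smul_sub]
    exact Submodule.smul_mem _ c hx
  | mem x hx =>
    obtain ⟨m, l, h, rfl⟩ := hx
    induction hB using Submodule.span_induction with
    | zero => simp
    | add x y _ _ hx hy =>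
      rw [mul_add, add_mul, add_sub_add_comm]
      exact Submodule.add_mem _ hx hy
    | smul c x _ hx =>
      rw [smul_mul_assoc, mul_smul_comm, ← smul_sub]
      exact Submodule.smul_mem _ c hx
    | mem x hx =>
      obtain ⟨m', l', h', rfl⟩ := hx
      rw [tAd_commutator]
      refine Submodule.smul_mem _ _ ?_
      have e1 : m • γ + l • γ' + (m' • γ + l' • γ') = (m + m') • γ + (l + l') • γ' := by
        rw [add_smul, add_smul]; abel
      have e2 : m + l + (m' + l') = (m + m') + (l + l') := by omega
      rw [e1, e2]
      exact tAd_mem_coneLie (by omega)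

theorem delta_mem_coneLie {A : Module.End ℚ (Trunc N)} (hA : A ∈ coneLie N γ γ') :
    delta N A ∈ coneLie N γ γ' := by
  induction hA using Submodule.span_induction with
  | zero => simp
  | add x y _ _ hx hy =>
    rw [map_add]
    exact Submodule.add_mem _ hx hy
  | smul c x _ hx =>
    rw [map_smul]
    exact Submodule.smul_mem _ c hx
  | mem x hx =>
    obtain ⟨m, l, h, rfl⟩ := hx
    rw [delta_tMul]
    exact Submodule.smul_mem _ _ (tAd_mem_coneLie h)

theorem ksLog_mem_coneLie {m l : ℕ} (h : 1 ≤ m + l) :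
    ksLog N (m + l) (m • γ + l • γ') ∈ coneLie N γ γ' := by
  refine Submodule.sum_mem _ fun k hk => Submodule.smul_mem _ _ ?_
  have hk1 := (Finset.mem_Icc.1 hk).1
  rw [smul_add, smul_smul, smul_smul, mul_add]
  exact tAd_mem_coneLie (by nlinarith)

/-- Multiplication by `t`. -/
abbrev tShift (N : ℕ) : Module.End ℚ (Trunc N) := tMul N 1 1

theorem commute_tMul_tShift (N d : ℕ) (A : Module.End ℚ TorusLie) :
    Commute (tMul N d A) (tShift N) := by
  show _ * _ = _ * _
  rw [tMul_mul, tMul_mul, mul_one, one_mul, add_comm d]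

theorem commute_ksLog_tShift (N d : ℕ) (γ : Charge) : Commute (ksLog N d γ) (tShift N) :=
  Commute.sum_left _ _ _ fun _ _ => (commute_tMul_tShift N _ _).smul_left _

theorem commute_exp {A : Type*} [Ring A] [Algebra ℚ A] {a b : A} (h : Commute a b) :
    Commute (IsNilpotent.exp a) b :=
  Commute.sum_left _ _ _ fun i _ => (h.pow_left i).smul_left _

/-- The invertible `t`-linear operators `T = 1 + O(t)` that normalise the Lie algebra of the cone
and whose logarithmic derivative `T⁻¹ (t d/dt) T` lies in it. They form a group, which contains the
ray elements; by the condition on the logarithmic derivative, the leading term of an element of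
this group lies in the Lie algebra of the cone. -/
def coneGroup (N : ℕ) (γ γ' : Charge) : Subgroup (Module.End ℚ (Trunc N))ˣ where
  carrier := {u | Commute (u : Module.End ℚ (Trunc N)) (tShift N) ∧
    ((u : Module.End ℚ (Trunc N)) - 1 ∈ tOrder N 1 ∧
      ((u⁻¹ : (Module.End ℚ (Trunc N))ˣ) : Module.End ℚ (Trunc N)) - 1 ∈ tOrder N 1) ∧
    (∀ X ∈ coneLie N γ γ', (u : Module.End ℚ (Trunc N)) * X * (u⁻¹ : (Module.End ℚ (Trunc N))ˣ) ∈
      coneLie N γ γ' ∧ ((u⁻¹ : (Module.End ℚ (Trunc N))ˣ) : Module.End ℚ (Trunc N)) * X * u ∈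
      coneLie N γ γ') ∧
    ((u⁻¹ : (Module.End ℚ (Trunc N))ˣ) : Module.End ℚ (Trunc N)) * delta N u ∈ coneLie N γ γ'}
  one_mem' := by
    refine ⟨?_, ?_, ?_, ?_⟩
    · exact Commute.one_left _
    · simp
    · intro X hX
      simpa using hX
    · simp [delta_one]
  mul_mem' := by
    rintro u v ⟨hu1, hu2, hu3, hu4⟩ ⟨hv1, hv2, hv3, hv4⟩
    refine ⟨?_, ⟨?_, ?_⟩, ?_, ?_⟩
    · rw [Units.val_mul]
      exact hu1.mul_left hv1
    · rw [Units.val_mul]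
      exact mul_sub_one_mem_raising zero_le_one hu2.1 hv2.1
    · rw [mul_inv_rev, Units.val_mul]
      exact mul_sub_one_mem_raising zero_le_one hv2.2 hu2.2
    · intro X hX
      rw [mul_inv_rev, Units.val_mul, Units.val_mul]
      constructor
      · have := (hu3 _ (hv3 X hX).1).1
        simpa only [mul_assoc] using this
      · have := (hv3 _ (hu3 X hX).2).2
        simpa only [mul_assoc] using this
    · rw [mul_inv_rev, Units.val_mul, Units.val_mul, delta_mul, mul_add]
      refine Submodule.add_mem _ ?_ ?_
      · have := (hv3 _ hu4).2
        simpa only [mul_assoc] using this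
      · simpa only [mul_assoc, Units.inv_mul_cancel_left] using hv4
  inv_mem' := by
    rintro u ⟨hu1, hu2, hu3, hu4⟩
    refine ⟨hu1.units_inv_left, ?_, ?_, ?_⟩
    · rw [inv_inv]
      exact hu2.symm
    · intro X hX
      rw [inv_inv]
      exact (hu3 X hX).symm
    · have h1 : (u : Module.End ℚ (Trunc N)) * delta N ((u⁻¹ : (Module.End ℚ (Trunc N))ˣ)) =
          -(delta N u * (u⁻¹ : (Module.End ℚ (Trunc N))ˣ)) := by
        rw [eq_neg_iff_add_eq_zero, add_comm (_ * _), ← delta_mul, Units.mul_inv, delta_one]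
      rw [inv_inv, h1]
      refine Submodule.neg_mem _ ?_
      have := (hu3 _ hu4).1
      rwa [Units.mul_inv_cancel_left] at this

/-- An operator lies in the group of the cone. -/
def InConeGroup (N : ℕ) (γ γ' : Charge) (T : Module.End ℚ (Trunc N)) : Prop :=
  ∃ u ∈ coneGroup N γ γ', (u : Module.End ℚ (Trunc N)) = T

theorem inConeGroup_ksPow {m l : ℕ} (h : 1 ≤ m + l) (c : ℚ) :
    InConeGroup N γ γ' (ksPow N (m + l) (m • γ + l • γ') c) := by
  have hm : c • ksLog N (m + l) (m • γ + l • γ') ∈ coneLie N γ γ' :=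
    Submodule.smul_mem _ _ (ksLog_mem_coneLie h)
  have hn := isNilpotent_smul_ksLog N h (m • γ + l • γ') c
  have hO : ∀ a : ℚ, ksPow N (m + l) (m • γ + l • γ') a - 1 ∈ tOrder N 1 := fun a =>
    ksPow_sub_one_mem_raising h _ _ zero_le_one (by simp; exact_mod_cast h)
  have hneg : ksPow N (m + l) (m • γ + l • γ') (-c) =
      IsNilpotent.exp (-(c • ksLog N (m + l) (m • γ + l • γ'))) := by rw [ksPow, neg_smul]
  refine ⟨⟨ksPow N (m + l) (m • γ + l • γ') c, ksPow N (m + l) (m • γ + l • γ') (-c),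
    ksPow_mul_neg N h _ _, ksPow_neg_mul N h _ _⟩, ⟨?_, ⟨hO _, hO _⟩, ?_, ?_⟩, rfl⟩
  · exact commute_exp ((commute_ksLog_tShift N _ _).smul_left _)
  · intro X hX
    have h1 := exp_conj_mem hn _ (fun x hx => commutator_mem_coneLie hm hx) hX
    have h2 := exp_conj_mem hn.neg _
      (fun x hx => commutator_mem_coneLie (Submodule.neg_mem _ hm) hx) hX
    rw [neg_neg, ← hneg] at h2
    rw [← hneg] at h1
    exact ⟨h1, h2⟩
  · rw [Units.inv_mk, delta_ksPow N h, ← mul_assoc, ksPow_neg_mul N h, one_mul]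
    exact Submodule.smul_mem _ _ (delta_mem_coneLie (ksLog_mem_coneLie h))

theorem inConeGroup_list_prod (L : List (Module.End ℚ (Trunc N)))
    (h : ∀ A ∈ L, InConeGroup N γ γ' A) : InConeGroup N γ γ' L.prod := by
  induction L with
  | nil => exact ⟨1, Subgroup.one_mem _, rfl⟩
  | cons A L ih =>
    obtain ⟨u, hu, rfl⟩ := h A (by simp)
    obtain ⟨v, hv, hv'⟩ := ih fun B hB => h B (by simp [hB])
    exact ⟨u * v, Subgroup.mul_mem _ hu hv, by rw [List.prod_cons, Units.val_mul, hv']⟩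

theorem inConeGroup_rayElement (Ω : Charge → ℚ) {p : ℕ × ℕ} (hp : 1 ≤ p.1 + p.2) :
    InConeGroup N γ γ' (rayElement N γ γ' Ω p) := by
  refine inConeGroup_list_prod _ fun A hA => ?_
  obtain ⟨i, _, rfl⟩ := List.mem_map.1 hA
  rw [succ_nsmul_ray, mul_add]
  exact inConeGroup_ksPow (by rw [← mul_add]; exact Nat.mul_pos (Nat.succ_pos i) hp) _

theorem inConeGroup_prod_rayElement (Ω : Charge → ℚ) {L : List (ℕ × ℕ)}
    (h : ∀ p ∈ L, p ∈ rayList N) :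
    InConeGroup N γ γ' (L.map (rayElement N γ γ' Ω)).prod := by
  refine inConeGroup_list_prod _ fun A hA => ?_
  obtain ⟨p, hp, rfl⟩ := List.mem_map.1 hA
  exact inConeGroup_rayElement Ω (one_le_of_mem_rayList (h p hp))

/-! ### The leading term of an element of the group -/

/-- A `t`-linear operator that vanishes in degree `≤ N` has order `N + 1`: on `t g` it is `t` times
its value on `g`, so that only the constant terms matter. -/
theorem mem_tOrder_of_truncate {A : Module.End ℚ (Trunc (N + 1))}
    (hA : Commute A (tShift (N + 1))) (h : truncate N ∘ₗ A = 0) :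
    A ∈ tOrder (N + 1) ((N + 1 : ℕ) : ℤ) := by
  have hlow : ∀ f : Trunc (N + 1), ∀ j : Fin (N + 2), (j : ℕ) < N + 1 → A f j = 0 := by
    intro f j hj
    exact congr_fun (LinearMap.congr_fun h f) ⟨j, hj⟩
  intro a f hf j ρ hj
  simp only [one_mul, AddMonoidHom.zero_apply, add_zero] at hj
  rcases lt_or_ge (j : ℕ) (N + 1) with h1 | h1
  · rw [hlow f j h1, map_zero]
  · have h0 : f 0 = 0 := TorusLie.ext_coef fun ρ => by
      rw [hf 0 ρ (by
        simp only [Fin.val_zero, Nat.cast_zero, mul_zero, AddMonoidHom.zero_apply]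
        omega), map_zero]
    let g : Trunc (N + 1) := fun i => if h : (i : ℕ) < N + 1 then f ⟨i + 1, by omega⟩ else 0
    have hg : f = tShift (N + 1) g := by
      funext i
      rw [tMul_apply]
      split_ifs with hi
      · simp only [Module.End.one_apply, g]
        rw [dif_pos (by omega)]
        congr 1
        exact Fin.ext (by simp; omega)
      · have : i = 0 := Fin.ext (by rw [Fin.val_zero]; omega)
        rw [this, h0]
    have hAg : A f = tShift (N + 1) (A g) := by
      conv_lhs => rw [hg]
      exact LinearMap.congr_fun hA.eq g
    rw [hAg, tMul_apply]
    split_ifs with hi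
    · rw [hlow g _ (by simp; omega)]
      simp
    · simp

theorem delta_of_mem_tOrder {A : Module.End ℚ (Trunc N)} (hA : A ∈ tOrder N N) :
    delta N A = (N : ℚ) • A := by
  refine LinearMap.ext fun f => funext fun j => ?_
  have h0 : ∀ g : Trunc N, ∀ i : Fin (N + 1), (i : ℕ) < N → A g i = 0 := by
    intro g i hi
    refine TorusLie.ext_coef fun ρ => ?_
    rw [hA 0 g _ i ρ (by simp; omega), map_zero]
    intro i' ρ' hi'
    simp at hi'
    omega
  have h1 : A (euler N f) = 0 := by
    refine funext fun i => TorusLie.ext_coef fun ρ => ?_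
    rw [hA 1 _ _ i ρ (by simp; omega)]
    · simp
    · intro i' ρ' hi'
      have : (i' : ℕ) = 0 := by
        simp only [one_mul, AddMonoidHom.zero_apply, add_zero] at hi'
        omega
      rw [euler_apply, this]
      simp
  rw [delta_apply, LinearMap.sub_apply, Module.End.mul_apply, Module.End.mul_apply, h1, sub_zero,
    euler_apply, LinearMap.smul_apply, Pi.smul_apply]
  rcases lt_or_ge (j : ℕ) N with h | h
  · rw [h0 f j h, smul_zero, smul_zero]
  · rw [show (j : ℕ) = N by omega]

/-- The part of degree `N` of an operator. -/
def topPart (N : ℕ) : Module.End ℚ (Module.End ℚ (Trunc N)) where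
  toFun A := tMul N N
    ((LinearMap.proj (Fin.last N)) ∘ₗ A ∘ₗ LinearMap.single ℚ (fun _ => TorusLie) (0 : Fin (N + 1)))
  map_add' A B := by
    rw [← tMul_add, LinearMap.add_comp, LinearMap.comp_add]
  map_smul' c A := by
    rw [RingHom.id_apply, ← tMul_smul, LinearMap.smul_comp, LinearMap.comp_smul]

theorem topPart_tMul (d : ℕ) (A : Module.End ℚ TorusLie) :
    topPart N (tMul N d A) = if d = N then tMul N N A else 0 := by
  have h : ∀ B : Module.End ℚ (Trunc N), topPart N B = tMul N N ((LinearMap.proj (Fin.last N)) ∘ₗ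
    B ∘ₗ LinearMap.single ℚ (fun _ => TorusLie) (0 : Fin (N + 1))) := fun _ => rfl
  rw [h]
  have h2 : ∀ B : Module.End ℚ TorusLie, B = 0 → tMul N N B = 0 := by
    rintro _ rfl
    have := tMul_smul N N 0 0
    rwa [zero_smul, zero_smul] at this
  split_ifs with hd
  · subst hd
    congr 1
    refine LinearMap.ext fun x => ?_
    have h3 : (⟨d - d, by omega⟩ : Fin (d + 1)) = 0 := Fin.ext (by simp)
    have h4 : (Pi.single 0 x : Trunc d) ⟨d - d, by omega⟩ = x := by rw [h3, Pi.single_eq_same]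
    simp only [LinearMap.comp_apply, LinearMap.proj_apply, tMul_apply, Fin.val_last, le_refl,
      if_true, LinearMap.single_apply]
    exact congr_arg A h4
  · refine h2 _ (LinearMap.ext fun x => ?_)
    simp only [LinearMap.comp_apply, LinearMap.proj_apply, tMul_apply, LinearMap.zero_apply]
    split_ifs with h3
    · rw [LinearMap.single_apply, Pi.single_eq_of_ne, map_zero]
      intro h4
      have := congr_arg Fin.val h4
      simp at this h3
      omega
    · rfl

theorem topPart_of_mem_tOrder {A : Module.End ℚ (Trunc N)} (hA : A ∈ tOrder N N) :
    topPart N A = A := by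
  refine LinearMap.ext fun f => funext fun j => ?_
  have h : topPart N A f j = if N ≤ (j : ℕ) then
    A (Pi.single 0 (f ⟨(j : ℕ) - N, by omega⟩)) (Fin.last N) else 0 := rfl
  rw [h]
  refine TorusLie.ext_coef fun ρ => ?_
  split_ifs with hj
  · have hj' : j = Fin.last N := Fin.ext (by simp; omega)
    subst hj'
    have h1 : A (f - Pi.single 0 (f 0)) (Fin.last N) = 0 := by
      refine TorusLie.ext_coef fun ρ => ?_
      rw [hA 1 _ _ (Fin.last N) ρ (by simp), map_zero]
      intro i' ρ' hi'
      have : i' = 0 := Fin.ext (by simp at hi' ⊢; omega)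
      rw [this]
      simp
    rw [map_sub, Pi.sub_apply, sub_eq_zero] at h1
    rw [h1]
    congr 3
    simp
  · symm
    rw [hA 0 f _ j ρ (by simp; omega), map_zero]
    intro i' ρ' hi'
    simp at hi'
    omega

theorem exists_eq_sum_of_mem_coneLie {X : Module.End ℚ (Trunc N)}
    (hX : X ∈ coneLie N γ γ') (hX' : X ∈ tOrder N N) :
    ∃ c : ℕ → ℚ, X = ∑ m ∈ Finset.range (N + 1), c m • tAd N N (m • γ + (N - m) • γ') := by
  suffices h : ∃ c : ℕ → ℚ, topPart N X =
      ∑ m ∈ Finset.range (N + 1), c m • tAd N N (m • γ + (N - m) • γ') by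
    rwa [topPart_of_mem_tOrder hX'] at h
  clear hX'
  induction hX using Submodule.span_induction with
  | zero => exact ⟨0, by simp⟩
  | add x y _ _ hx hy =>
    obtain ⟨a, ha⟩ := hx
    obtain ⟨b, hb⟩ := hy
    exact ⟨a + b, by
      rw [map_add, ha, hb, ← Finset.sum_add_distrib]; simp only [Pi.add_apply, add_smul]⟩
  | smul r x _ hx =>
    obtain ⟨a, ha⟩ := hx
    exact ⟨r • a, by
      rw [map_smul, ha, Finset.smul_sum]; simp only [Pi.smul_apply, smul_eq_mul, mul_smul]⟩
  | mem x hx =>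
    obtain ⟨m, l, h, rfl⟩ := hx
    rw [topPart_tMul]
    split_ifs with h1
    · refine ⟨fun i => if i = m then 1 else 0, ?_⟩
      rw [Finset.sum_eq_single m]
      · simp only [if_true]
        rw [one_smul, show N - m = l by omega]
      · intro i _ hi
        simp only [if_neg hi, zero_smul]
      · intro hm
        simp at hm
        omega
    · exact ⟨0, by simp⟩

/-- Two elements of the group of the cone that agree up to degree `N` differ in degree `N + 1` by
an element of the Lie algebra. -/
theorem exists_sub_eq_sum {T T' : Module.End ℚ (Trunc (N + 1))} (hT : InConeGroup (N + 1) γ γ' T)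
    (hT' : InConeGroup (N + 1) γ γ' T') (h : truncate N ∘ₗ T = truncate N ∘ₗ T') :
    ∃ c : ℕ → ℚ, T - T' = ∑ m ∈ Finset.range (N + 2),
      c m • tAd (N + 1) (N + 1) (m • γ + (N + 1 - m) • γ') := by
  obtain ⟨u, hu, rfl⟩ := hT
  obtain ⟨v, hv, rfl⟩ := hT'
  have hO : (u : Module.End ℚ (Trunc (N + 1))) - v ∈ tOrder (N + 1) ((N + 1 : ℕ) : ℤ) := by
    refine mem_tOrder_of_truncate (hu.1.sub_left hv.1) ?_
    rw [LinearMap.comp_sub, h, sub_self]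
  have hkill : ∀ A B : Module.End ℚ (Trunc (N + 1)), A ∈ tOrder (N + 1) ((N + 1 : ℕ) : ℤ) →
      B ∈ tOrder (N + 1) 1 → A * B = 0 ∧ B * A = 0 := fun A B hA hB =>
    ⟨eq_zero_of_mem_tOrder (by push_cast; omega) (mul_mem_raising hA hB),
      eq_zero_of_mem_tOrder (by push_cast; omega) (mul_mem_raising hB hA)⟩
  obtain ⟨-, ⟨hw1, -⟩, -, hw⟩ := Subgroup.mul_mem _ (Subgroup.inv_mem _ hv) hu
  obtain ⟨-, ⟨-, hv'⟩, -, -⟩ := hv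
  -- the quotient is `1 + D`, where `D` is the difference
  have hw2 : ((v⁻¹ * u : (Module.End ℚ (Trunc (N + 1)))ˣ) : Module.End ℚ (Trunc (N + 1))) =
      1 + ((u : Module.End ℚ (Trunc (N + 1))) - v) := by
    have := (hkill _ _ hO hv').2
    rw [sub_mul, one_mul, mul_sub, Units.inv_mul, sub_eq_zero] at this
    rw [Units.val_mul, ← this]
    abel
  set D := (u : Module.End ℚ (Trunc (N + 1))) - v with hD
  have hXD : (((v⁻¹ * u)⁻¹ : (Module.End ℚ (Trunc (N + 1)))ˣ) : Module.End ℚ (Trunc (N + 1))) *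
      delta (N + 1) ((v⁻¹ * u : (Module.End ℚ (Trunc (N + 1)))ˣ)) = ((N + 1 : ℕ) : ℚ) • D := by
    set X := (((v⁻¹ * u)⁻¹ : (Module.End ℚ (Trunc (N + 1)))ˣ) : Module.End ℚ (Trunc (N + 1))) *
      delta (N + 1) ((v⁻¹ * u : (Module.End ℚ (Trunc (N + 1)))ˣ)) with hX
    have h1 : delta (N + 1) ((v⁻¹ * u : (Module.End ℚ (Trunc (N + 1)))ˣ)) =
        ((v⁻¹ * u : (Module.End ℚ (Trunc (N + 1)))ˣ) : Module.End ℚ (Trunc (N + 1))) * X := by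
      rw [hX, Units.mul_inv_cancel_left]
    have h2 := (hkill _ _ hO (coneLie_le_tOrder hw)).1
    rw [hw2, add_mul, one_mul, h2, add_zero, map_add, delta_one, zero_add,
      delta_of_mem_tOrder hO] at h1
    exact h1.symm
  rw [hXD] at hw
  have hne : ((N + 1 : ℕ) : ℚ) ≠ 0 := by exact_mod_cast Nat.succ_ne_zero N
  exact exists_eq_sum_of_mem_coneLie ((Submodule.smul_mem_iff _ hne).1 hw) hO

end cone

/-! ### Solutions of the wall crossing formula exist -/

theorem eq_of_ray_eq {γ γ' : Charge} (hp : pairing γ γ' ≠ 0) {m l m' l' : ℕ}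
    (h : m • γ + l • γ' = m' • γ + l' • γ') : m = m' ∧ l = l' := by
  have h1 := congr_arg (pairing γ) h
  have h2 := congr_arg (fun x => pairing x γ') h
  simp only [pairing_add_left, pairing_add_right, pairing_nsmul_left, pairing_nsmul_right,
    pairing_self, mul_zero, zero_add, add_zero] at h1 h2
  exact ⟨by exact_mod_cast mul_right_cancel₀ hp h2, by exact_mod_cast mul_right_cancel₀ hp h1⟩

theorem ksPow_top {N : ℕ} (hN : 1 ≤ N) (μ : Charge) (c : ℚ) :
    ksPow N N μ c = 1 + c • tAd N N μ := by
  have h1 : ksLog N N μ = tAd N N μ := by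
    unfold ksLog
    rw [Finset.sum_eq_single 1]
    · simp
    · intro k hk hk1
      have := (Finset.mem_Icc.1 hk).1
      rw [tMul_of_lt (by nlinarith [show 2 ≤ k by omega]), smul_zero]
    · intro h
      simp at h
      omega
  have h2 : (c • tAd N N μ) ^ 2 = 0 := by
    rw [smul_pow, pow_two (tAd N N μ), tMul_mul, tMul_of_lt (by omega), smul_zero]
  rw [ksPow, h1, IsNilpotent.exp_eq_sum h2]
  simp [Finset.sum_range_succ]

/-- Perturbing the factors of a product of operators `1 + O(t)` in the top degree perturbs the
product by the sum of the perturbations. -/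
theorem list_prod_add {N : ℕ} (hN : 1 ≤ N) {ι : Type*} (f g : ι → Module.End ℚ (Trunc N))
    (L : List ι) (hf : ∀ i ∈ L, f i - 1 ∈ tOrder N 1) (hg : ∀ i ∈ L, g i ∈ tOrder N N) :
    (L.map fun i => f i + g i).prod = (L.map f).prod + (L.map g).sum ∧
      (L.map g).sum ∈ tOrder N N := by
  induction L with
  | nil => simp
  | cons a L ih =>
    obtain ⟨ih1, ih2⟩ := ih (fun i hi => hf i (by simp [hi])) fun i hi => hg i (by simp [hi])
    have hfa := hf a (by simp)
    have hga := hg a (by simp)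
    have hP : (L.map f).prod - 1 ∈ tOrder N 1 :=
      list_prod_sub_one_mem_raising zero_le_one _ fun A hA => by
        obtain ⟨i, hi, rfl⟩ := List.mem_map.1 hA
        exact hf i (by simp [hi])
    simp only [List.map_cons, List.prod_cons, List.sum_cons]
    refine ⟨?_, Submodule.add_mem _ hga ih2⟩
    have e1 : (f a - 1) * (L.map g).sum = 0 :=
      eq_zero_of_mem_tOrder (by omega) (mul_mem_raising hfa ih2)
    have e2 : g a * ((L.map f).prod - 1) = 0 :=
      eq_zero_of_mem_tOrder (by omega) (mul_mem_raising hga hP)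
    have e3 : g a * (L.map g).sum = 0 :=
      eq_zero_of_mem_tOrder (by omega) (mul_mem_raising hga ih2)
    rw [sub_mul, one_mul, sub_eq_zero] at e1
    rw [mul_sub, mul_one, sub_eq_zero] at e2
    rw [ih1, add_mul, mul_add, mul_add, e1, e2, e3]
    abel

section perturbation

variable {N : ℕ} {γ γ' : Charge}

theorem ksPow_add_top (hN : 1 ≤ N) (d : ℕ) (μ : Charge) (a b : ℚ) (h : d < N → b = 0) :
    ksPow N d μ (a + b) = ksPow N d μ a + b • tAd N d μ := by
  rcases lt_trichotomy d N with h1 | rfl | h1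
  · rw [h h1, add_zero, zero_smul, add_zero]
  · rw [ksPow_top hN, ksPow_top hN, add_smul, add_assoc]
  · rw [ksPow_of_lt h1, ksPow_of_lt h1, tAd, tMul_of_lt h1, smul_zero, add_zero]

theorem smul_tAd_mem_tOrder (d : ℕ) (μ : Charge) (b : ℚ) (h : d < N → b = 0) :
    b • tAd N d μ ∈ tOrder N N := by
  rcases lt_or_ge d N with h1 | h1
  · rw [h h1, zero_smul]
    exact Submodule.zero_mem _
  · exact Submodule.smul_mem _ _ (raising_antitone (by exact_mod_cast h1) (tAd_mem_tOrder N d μ))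

/-- Changing the invariants in degree `N` changes a product of ray elements by the corresponding
element of the Lie algebra. -/
theorem prod_rayElement_add (hN : 1 ≤ N) (Ω η : Charge → ℚ)
    (hη : ∀ m l : ℕ, m + l < N → η (m • γ + l • γ') = 0) (L : List (ℕ × ℕ))
    (hL : ∀ p ∈ L, 1 ≤ p.1 + p.2) :
    (L.map (rayElement N γ γ' (Ω + η))).prod = (L.map (rayElement N γ γ' Ω)).prod +
      (L.map fun p => ((List.range N).map fun i => η (((i + 1) * p.1) • γ + ((i + 1) * p.2) • γ') •
        tAd N ((i + 1) * p.1 + (i + 1) * p.2)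
          (((i + 1) * p.1) • γ + ((i + 1) * p.2) • γ')).sum).sum := by
  have key : ∀ p : ℕ × ℕ, 1 ≤ p.1 + p.2 → rayElement N γ γ' (Ω + η) p = rayElement N γ γ' Ω p +
      ((List.range N).map fun i => η (((i + 1) * p.1) • γ + ((i + 1) * p.2) • γ') •
        tAd N ((i + 1) * p.1 + (i + 1) * p.2)
          (((i + 1) * p.1) • γ + ((i + 1) * p.2) • γ')).sum ∧
      ((List.range N).map fun i => η (((i + 1) * p.1) • γ + ((i + 1) * p.2) • γ') •
        tAd N ((i + 1) * p.1 + (i + 1) * p.2)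
          (((i + 1) * p.1) • γ + ((i + 1) * p.2) • γ')).sum ∈ tOrder N N := by
    intro p hp
    have := list_prod_add hN (fun i => ksPow N ((i + 1) * (p.1 + p.2))
      ((i + 1) • (p.1 • γ + p.2 • γ')) (Ω ((i + 1) • (p.1 • γ + p.2 • γ'))))
      (fun i => η (((i + 1) * p.1) • γ + ((i + 1) * p.2) • γ') •
        tAd N ((i + 1) * p.1 + (i + 1) * p.2) (((i + 1) * p.1) • γ + ((i + 1) * p.2) • γ'))
      (List.range N) ?_ ?_
    · refine ⟨?_, this.2⟩
      unfold rayElement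
      rw [← this.1]
      congr 1
      refine List.map_congr_left fun i _ => ?_
      rw [Pi.add_apply, succ_nsmul_ray, mul_add, ksPow_add_top hN _ _ _ _ (hη _ _)]
    · intro i _
      exact ksPow_sub_one_mem_raising (Nat.mul_pos (Nat.succ_pos i) hp) _ _ zero_le_one
        (by simp only [one_mul, AddMonoidHom.zero_apply, add_zero]
            exact_mod_cast Nat.mul_pos (Nat.succ_pos i) hp)
    · intro i _
      exact smul_tAd_mem_tOrder _ _ _ (hη _ _)
  rw [← (list_prod_add hN _ _ L (fun p hp => rayElement_sub_one_mem_tOrder (hL p hp))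
    fun p hp => (key p (hL p hp)).2).1]
  congr 1
  exact List.map_congr_left fun p hp => (key p (hL p hp)).1

/-- The lattice points of degree `N` of the cone are the multiples of the primitive ones. -/
theorem sum_rayList_eq {M : Type*} [AddCommMonoid M] (hN : 1 ≤ N) (G : ℕ → ℕ → M)
    (hG : ∀ m l, m + l ≠ N → G m l = 0) {L : List (ℕ × ℕ)} (hL : L.Perm (rayList N)) :
    (L.map fun p => ((List.range N).map fun i => G ((i + 1) * p.1) ((i + 1) * p.2)).sum).sum =
      ∑ m ∈ Finset.range (N + 1), G m (N - m) := by
  rw [(hL.map _).sum_eq, ← List.sum_toFinset _ (nodup_rayList N)]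
  have h1 : ∀ p : ℕ × ℕ, ((List.range N).map fun i => G ((i + 1) * p.1) ((i + 1) * p.2)).sum =
      ∑ i ∈ Finset.range N, G ((i + 1) * p.1) ((i + 1) * p.2) := by
    intro p
    rw [← List.sum_toFinset _ List.nodup_range, List.toFinset_range]
  simp only [h1]
  rw [← Finset.sum_product']
  have h2 : ∑ x ∈ (rayList N).toFinset ×ˢ Finset.range N,
      G ((x.2 + 1) * x.1.1) ((x.2 + 1) * x.1.2) =
      ∑ x ∈ ((rayList N).toFinset ×ˢ Finset.range N).filter
        (fun x => (x.2 + 1) * x.1.1 + (x.2 + 1) * x.1.2 = N),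
        G ((x.2 + 1) * x.1.1) ((x.2 + 1) * x.1.2) := by
    rw [Finset.sum_filter]
    refine Finset.sum_congr rfl fun x _ => ?_
    split_ifs with h
    · rfl
    · exact hG _ _ h
  rw [h2]
  refine Finset.sum_nbij' (fun x => (x.2 + 1) * x.1.1)
    (fun m => ((m / Nat.gcd m (N - m), (N - m) / Nat.gcd m (N - m)), Nat.gcd m (N - m) - 1))
    ?_ ?_ ?_ ?_ ?_
  · rintro ⟨⟨m, l⟩, i⟩ hx
    simp only [Finset.mem_filter] at hx
    simp only [Finset.mem_range]
    omega
  · intro m hm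
    simp only [Finset.mem_range] at hm
    have hg : 0 < Nat.gcd m (N - m) := Nat.gcd_pos_iff.2 (by omega)
    have hgN : Nat.gcd m (N - m) ≤ N := by
      have : Nat.gcd m (N - m) ∣ m + (N - m) :=
        Nat.dvd_add (Nat.gcd_dvd_left _ _) (Nat.gcd_dvd_right _ _)
      rw [show m + (N - m) = N by omega] at this
      exact Nat.le_of_dvd (by omega) this
    simp only [Finset.mem_filter, Finset.mem_product, List.mem_toFinset, mem_rayList,
      Finset.mem_range]
    refine ⟨⟨⟨Nat.coprime_div_gcd_div_gcd hg, ?_⟩, by omega⟩, ?_⟩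
    · have := Nat.div_le_self m (Nat.gcd m (N - m))
      have := Nat.div_le_self (N - m) (Nat.gcd m (N - m))
      omega
    · rw [Nat.sub_add_cancel hg, Nat.mul_div_cancel' (Nat.gcd_dvd_left _ _),
        Nat.mul_div_cancel' (Nat.gcd_dvd_right _ _)]
      omega
  · rintro ⟨⟨m, l⟩, i⟩ hx
    simp only [Finset.mem_filter, Finset.mem_product, List.mem_toFinset, mem_rayList,
      Finset.mem_range] at hx
    have e : N - (i + 1) * m = (i + 1) * l := by omega
    have hc : Nat.gcd m l = 1 := hx.1.1.1
    simp only [e, Nat.gcd_mul_left, hc, mul_one, Nat.mul_div_cancel_left _ (Nat.succ_pos i),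
      Nat.add_sub_cancel]
  · intro m hm
    simp only [Finset.mem_range] at hm
    have hg : 0 < Nat.gcd m (N - m) := Nat.gcd_pos_iff.2 (by omega)
    simp only
    rw [Nat.sub_add_cancel hg, Nat.mul_div_cancel' (Nat.gcd_dvd_left _ _)]
  · rintro ⟨⟨m, l⟩, i⟩ hx
    simp only [Finset.mem_filter] at hx
    simp only
    congr 1
    omega

/-- The wall crossing formula in degree `≤ N`. -/
def KSWCFUpTo (N : ℕ) (γ γ' : Charge) (Ω Ω' : Charge → ℚ) : Prop :=
  ((rayList N).map (rayElement N γ γ' Ω)).prod =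
    ((rayList N).reverse.map (rayElement N γ γ' Ω')).prod

theorem KSWCFUpTo.congr {Ω Ω' Ω'' : Charge → ℚ} (h : KSWCFUpTo N γ γ' Ω Ω')
    (h' : ∀ m l : ℕ, 1 ≤ m + l → m + l ≤ N → Ω' (m • γ + l • γ') = Ω'' (m • γ + l • γ')) :
    KSWCFUpTo N γ γ' Ω Ω'' := by
  refine Eq.trans h ?_
  congr 1
  refine List.map_congr_left fun p hp => ?_
  exact rayElement_congr h' (one_le_of_mem_rayList (List.mem_reverse.1 hp))

/-- A solution in degree `≤ N` extends to one in degree `≤ N + 1`. -/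
theorem KSWCFUpTo.exists_succ (hp : pairing γ γ' ≠ 0) {Ω Ω' : Charge → ℚ}
    (h : KSWCFUpTo N γ γ' Ω Ω') :
    ∃ Ω'', KSWCFUpTo (N + 1) γ γ' Ω Ω'' ∧
      ∀ m l : ℕ, m + l ≤ N → Ω'' (m • γ + l • γ') = Ω' (m • γ + l • γ') := by
  classical
  obtain ⟨c, hc⟩ := exists_sub_eq_sum
    (inConeGroup_prod_rayElement (N := N + 1) (γ := γ) (γ' := γ') Ω (L := rayList (N + 1))
      fun _ hp => hp)
    (inConeGroup_prod_rayElement (N := N + 1) (γ := γ) (γ' := γ') Ω'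
      (L := (rayList (N + 1)).reverse) fun _ hp => List.mem_reverse.1 hp)
    (by rw [← truncate_comp_prod, ← truncate_comp_prod_reverse, h])
  -- the correction of the invariants in degree `N + 1`
  let η : Charge → ℚ := fun μ => ∑ m ∈ Finset.range (N + 2),
    if μ = m • γ + (N + 1 - m) • γ' then c m else 0
  have hη0 : ∀ m l : ℕ, m + l ≠ N + 1 → η (m • γ + l • γ') = 0 := by
    intro m l hml
    refine Finset.sum_eq_zero fun i hi => if_neg fun h => hml ?_
    obtain ⟨rfl, rfl⟩ := eq_of_ray_eq hp h
    simp only [Finset.mem_range] at hi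
    omega
  have hη1 : ∀ m ∈ Finset.range (N + 2), η (m • γ + (N + 1 - m) • γ') = c m := by
    intro m hm
    simp only [η]
    rw [Finset.sum_eq_single m]
    · rw [if_pos rfl]
    · intro i _ him
      exact if_neg fun h => him (eq_of_ray_eq hp h).1.symm
    · exact fun h => absurd hm h
  refine ⟨Ω' + η, ?_, ?_⟩
  · unfold KSWCFUpTo
    rw [prod_rayElement_add (by omega) Ω' η (fun m l hml => hη0 m l (by omega)) _
      fun p hp => one_le_of_mem_rayList (List.mem_reverse.1 hp)]
    rw [sum_rayList_eq (by omega)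
      (fun m l => η (m • γ + l • γ') • tAd (N + 1) (m + l) (m • γ + l • γ'))
      (fun m l hml => by rw [hη0 m l hml, zero_smul]) (List.reverse_perm _)]
    rw [sub_eq_iff_eq_add'] at hc
    rw [hc]
    congr 1
    refine Finset.sum_congr rfl fun m hm => ?_
    rw [hη1 m hm]
    simp only [Finset.mem_range] at hm
    rw [show m + (N + 1 - m) = N + 1 by omega]
  · intro m l hml
    rw [Pi.add_apply, hη0 m l (by omega), add_zero]

/-- The formula has a solution on the other side of the wall for any invariants on the first side,
since the solutions in degree `≤ N` extend one another. -/
theorem exists_kswcf (hp : pairing γ γ' ≠ 0) (Ω : Charge → ℚ) : ∃ Ω', KSWCF γ γ' Ω Ω' := by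
  classical
  have h0 : KSWCFUpTo 0 γ γ' Ω 0 := by
    have : rayList 0 = [] := List.eq_nil_iff_forall_not_mem.2 fun p hp => by
      have h1 := one_le_of_mem_rayList hp
      have h2 := (mem_rayList.1 hp).2
      omega
    unfold KSWCFUpTo
    rw [this, List.reverse_nil, List.map_nil, List.map_nil]
  obtain ⟨s, hs0, hs⟩ : ∃ s : ℕ → Charge → ℚ, (∀ N, KSWCFUpTo N γ γ' Ω (s N)) ∧
      ∀ N m l : ℕ, m + l ≤ N → s (N + 1) (m • γ + l • γ') = s N (m • γ + l • γ') := by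
    choose f hf using fun (N : ℕ) (Ω' : {Ω' : Charge → ℚ // KSWCFUpTo N γ γ' Ω Ω'}) =>
      Ω'.2.exists_succ hp
    let s : ∀ N, {Ω' : Charge → ℚ // KSWCFUpTo N γ γ' Ω Ω'} :=
      fun N => Nat.rec ⟨0, h0⟩ (fun N Ω' => ⟨f N Ω', (hf N Ω').1⟩) N
    exact ⟨fun N => (s N).1, fun N => (s N).2, fun N => (hf N (s N)).2⟩
  have hs' : ∀ m l k : ℕ, s (m + l + k) (m • γ + l • γ') = s (m + l) (m • γ + l • γ') := by
    intro m l k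
    induction k with
    | zero => rw [add_zero]
    | succ k ih =>
      rw [← ih]
      exact hs (m + l + k) m l (Nat.le_add_right _ _)
  -- the limit of the solutions: in degree `d` it is the `d`-th one
  let Ω' : Charge → ℚ := fun μ =>
    if h : ∃ q : ℕ × ℕ, μ = q.1 • γ + q.2 • γ' then s (h.choose.1 + h.choose.2) μ else 0
  have hΩ' : ∀ m l : ℕ, Ω' (m • γ + l • γ') = s (m + l) (m • γ + l • γ') := by
    intro m l
    have h : ∃ q : ℕ × ℕ, m • γ + l • γ' = q.1 • γ + q.2 • γ' := ⟨(m, l), rfl⟩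
    simp only [Ω']
    rw [dif_pos h]
    have := eq_of_ray_eq hp h.choose_spec
    rw [← this.1, ← this.2]
  refine ⟨Ω', kswcf_iff.2 fun N => ?_⟩
  refine (hs0 N).congr fun m l _ hml => ?_
  obtain ⟨k, hk⟩ := Nat.exists_eq_add_of_le hml
  rw [hΩ', ← hs' m l k, hk]

end perturbation

/-! ### The wall crossing formula in degree two -/

theorem rayList_two : rayList 2 = [(1, 0), (1, 1), (0, 1)] := by
  refine ((isOrderedRays_rayList 2).unique ⟨?_, ?_⟩)
  · rintro ⟨m, l⟩
    constructor
    · intro h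
      simp only [List.mem_cons, Prod.mk.injEq, List.not_mem_nil, or_false] at h
      rcases h with ⟨rfl, rfl⟩ | ⟨rfl, rfl⟩ | ⟨rfl, rfl⟩ <;> simp
    · rintro ⟨h1, h2⟩
      simp only at h1 h2
      have hm : m ≤ 2 := by omega
      have hl : l ≤ 2 := by omega
      interval_cases m <;> interval_cases l <;> simp_all
  · simp [fromFirst]

theorem ksLog_two (μ : Charge) :
    ksLog 2 1 μ = tAd 2 1 μ + (1 / 4 : ℚ) • tAd 2 2 (2 • μ) := by
  unfold ksLog
  rw [Finset.sum_Icc_succ_top (by norm_num), Finset.Icc_self, Finset.sum_singleton]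
  norm_num

theorem ksPow_two (μ : Charge) (c : ℚ) :
    ksPow 2 1 μ c = 1 + c • tAd 2 1 μ + (c / 4) • tAd 2 2 (2 • μ) +
      (c ^ 2 / 2) • (tAd 2 1 μ * tAd 2 1 μ) := by
  have h0 : ∀ A B, tMul 2 1 A * tMul 2 2 B = 0 := fun A B => by
    rw [tMul_mul, tMul_of_lt (by norm_num)]
  have h1 : ∀ A B, tMul 2 2 A * tMul 2 1 B = 0 := fun A B => by
    rw [tMul_mul, tMul_of_lt (by norm_num)]
  have h2 : ∀ A B, tMul 2 2 A * tMul 2 2 B = 0 := fun A B => by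
    rw [tMul_mul, tMul_of_lt (by norm_num)]
  have hsq : (c • ksLog 2 1 μ) ^ 2 = c ^ 2 • (tAd 2 1 μ * tAd 2 1 μ) := by
    rw [smul_pow, ksLog_two, pow_two (tAd 2 1 μ + _)]
    simp only [mul_add, add_mul, smul_mul_assoc, mul_smul_comm, h0, h1, h2, smul_zero, add_zero]
  have hcu : (c • ksLog 2 1 μ) ^ 3 = 0 := by
    rw [pow_succ, hsq, ksLog_two, tMul_mul]
    simp only [mul_add, smul_mul_assoc, mul_smul_comm, h1, h2, smul_zero, add_zero]
  rw [ksPow, IsNilpotent.exp_eq_sum hcu, Finset.sum_range_succ, Finset.sum_range_succ,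
    Finset.sum_range_succ, hsq, ksLog_two]
  simp only [Finset.range_zero, Finset.sum_empty, pow_zero, pow_one, Nat.factorial]
  push_cast
  module

theorem rayElement_two {γ γ' : Charge} {Ω : Charge → ℚ} {p : ℕ × ℕ} (h : p.1 + p.2 = 1)
    {μ : Charge} (hμ : p.1 • γ + p.2 • γ' = μ) :
    ∃ s s' : ℚ, rayElement 2 γ γ' Ω p = 1 + Ω μ • tAd 2 1 μ + s • tAd 2 2 (2 • μ) +
      s' • (tAd 2 1 μ * tAd 2 1 μ) := by
  refine ⟨Ω μ / 4 + Ω (2 • μ), Ω μ ^ 2 / 2, ?_⟩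
  have e1 : rayElement 2 γ γ' Ω p = ksPow 2 1 μ (Ω μ) * ksPow 2 2 (2 • μ) (Ω (2 • μ)) := by
    unfold rayElement
    rw [h, hμ, show List.range 2 = [0, 1] from rfl]
    simp only [List.map_cons, List.map_nil, List.prod_cons, List.prod_nil, mul_one, zero_add,
      one_smul, one_add_one_eq_two]
  have h0 : ∀ A B, tMul 2 1 A * tMul 2 2 B = 0 := fun A B => by
    rw [tMul_mul, tMul_of_lt (by norm_num)]
  have h2 : ∀ A B, tMul 2 2 A * tMul 2 2 B = 0 := fun A B => by
    rw [tMul_mul, tMul_of_lt (by norm_num)]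
  rw [e1, ksPow_two, ksPow_top (by norm_num)]
  simp only [mul_add, add_mul, smul_mul_assoc, mul_smul_comm, mul_assoc, h0, h2, smul_zero,
    add_zero, mul_one, one_mul, mul_zero]
  module

theorem rayElement_two_diagonal {γ γ' : Charge} {Ω : Charge → ℚ} :
    rayElement 2 γ γ' Ω (1, 1) = 1 + Ω (γ + γ') • tAd 2 2 (γ + γ') := by
  unfold rayElement
  rw [show List.range 2 = [0, 1] from rfl]
  simp only [List.map_cons, List.map_nil, List.prod_cons, List.prod_nil, mul_one, zero_add,
    one_mul, one_smul]
  rw [ksPow_top (by norm_num), ksPow_of_lt (by norm_num), mul_one]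

theorem neg_one_zpow_ne_zero (k : ℤ) : ((-1 : ℚ) ^ k) ≠ 0 := zpow_ne_zero _ (by norm_num)

theorem coeff_ne_zero {a b : Charge} (h : pairing a b ≠ 0) : coeff a b ≠ 0 :=
  mul_ne_zero (neg_one_zpow_ne_zero _) (by exact_mod_cast h)

/-- Across the wall the invariant of `γ + γ'` jumps by
`(-1)^⟨γ,γ'⟩ ⟨γ,γ'⟩ Ω(γ) Ω(γ')`. -/
theorem KSWCF.apply_add {γ γ' : Charge} (hp : pairing γ γ' ≠ 0) {Ω Ω' : Charge → ℚ}
    (h : KSWCF γ γ' Ω Ω') :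
    Ω' (γ + γ') = Ω (γ + γ') + coeff γ γ' * (Ω γ * Ω γ') := by
  have hp' : pairing γ' γ ≠ 0 := by rw [pairing_swap]; exact neg_ne_zero.2 hp
  have hne : γ ≠ γ' := fun h => hp (by rw [h, pairing_self])
  have hγ : γ ≠ 0 := fun h => hp (by rw [h]; simp [pairing])
  have hγ' : γ' ≠ 0 := fun h => hp (by rw [h]; simp [pairing])
  have h2 := kswcf_iff.1 h 2
  rw [rayList_two] at h2
  simp only [List.reverse_cons, List.reverse_nil, List.nil_append, List.cons_append, List.map_cons,
    List.map_nil, List.prod_cons, List.prod_nil, mul_one] at h2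
  obtain ⟨s, s', hs⟩ := rayElement_two (γ := γ) (γ' := γ') (Ω := Ω) (p := (1, 0)) rfl
    (μ := γ) (by simp)
  obtain ⟨r, r', hr⟩ := rayElement_two (γ := γ) (γ' := γ') (Ω := Ω) (p := (0, 1)) rfl
    (μ := γ') (by simp)
  obtain ⟨v, v', hv⟩ := rayElement_two (γ := γ) (γ' := γ') (Ω := Ω') (p := (1, 0)) rfl
    (μ := γ) (by simp)
  obtain ⟨w, w', hw⟩ := rayElement_two (γ := γ) (γ' := γ') (Ω := Ω') (p := (0, 1)) rfl
    (μ := γ') (by simp)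
  rw [hs, hr, hv, hw, rayElement_two_diagonal, rayElement_two_diagonal] at h2
  have key : ∀ (ν ρ : Charge) (j : Fin 3), coef ρ
      (((1 + Ω γ • tAd 2 1 γ + s • tAd 2 2 (2 • γ) + s' • (tAd 2 1 γ * tAd 2 1 γ)) *
        ((1 + Ω (γ + γ') • tAd 2 2 (γ + γ')) *
          (1 + Ω γ' • tAd 2 1 γ' + r • tAd 2 2 (2 • γ') + r' • (tAd 2 1 γ' * tAd 2 1 γ'))))
        (monomial 2 0 ν) j) =
      coef ρ (((1 + Ω' γ' • tAd 2 1 γ' + w • tAd 2 2 (2 • γ') + w' • (tAd 2 1 γ' * tAd 2 1 γ')) *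
        ((1 + Ω' (γ + γ') • tAd 2 2 (γ + γ')) *
          (1 + Ω' γ • tAd 2 1 γ + v • tAd 2 2 (2 • γ) + v' • (tAd 2 1 γ * tAd 2 1 γ))))
        (monomial 2 0 ν) j) := by
    intro ν ρ j
    rw [h2]
  simp only [Module.End.mul_apply, LinearMap.add_apply, LinearMap.smul_apply, Module.End.one_apply,
    map_add, map_smul, tAd_monomial, Pi.add_apply, Pi.smul_apply, coef_monomial, smul_eq_mul] at key
  -- the coefficient of `t² e_{2γ+γ'}` in the image of `e_γ`, where `[e_γ, e_γ] = 0` removes all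
  -- terms but those of `e_{γ+γ'}` and of `e_γ e_γ'`
  have k3 := key γ (γ + γ + γ') 2
  have n0 : γ + γ' + γ' ≠ γ + γ + γ' := fun h => hne (by simpa using h.symm)
  have n1 : γ + 2 • γ' ≠ γ + γ + γ' := by rwa [two_smul, ← add_assoc]
  have n2 : γ + γ + γ ≠ γ + γ + γ' := fun h => hne (by simpa using h)
  have n3 : γ + 2 • γ ≠ γ + γ + γ' := by rwa [two_smul, ← add_assoc]
  have n4 : γ + γ' + γ = γ + γ + γ' := by abel
  have n5 : γ + (γ + γ') = γ + γ + γ' := by abel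
  simp [hγ, hγ', n0, n1, n2, n3, n4, n5, -nsmul_eq_mul, -Nat.cast_ofNat] at k3
  have c1 : coeff γ γ = 0 := by simp [coeff, pairing_self]
  have c2 : coeff (γ + γ') γ = coeff γ' γ := by simp [coeff, pairing_add_left, pairing_self]
  have c3 : coeff γ (γ + γ') = coeff γ γ' := by simp [coeff, pairing_add_right, pairing_self]
  rw [c1, c2, c3, zero_mul, mul_zero, add_zero] at k3
  refine mul_right_cancel₀ (coeff_ne_zero hp') ?_
  linear_combination -k3

/-! ### Explicit actions of Kontsevich-Soibelman transforms -/

theorem exp_apply_of_apply_eq_zero {N : ℕ} {A : Module.End ℚ (Trunc N)} (hn : IsNilpotent A)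
    {f : Trunc N} (h : A f = 0) : IsNilpotent.exp A f = f := by
  obtain ⟨k, hk⟩ := hn
  have hk' : A ^ (k + 1) = 0 := by rw [pow_succ, hk, zero_mul]
  rw [IsNilpotent.exp_eq_sum hk', Finset.sum_range_succ', LinearMap.add_apply, LinearMap.sum_apply,
    Finset.sum_eq_zero]
  · simp
  · intro i _
    rw [LinearMap.smul_apply, pow_succ, Module.End.mul_apply, h, map_zero, smul_zero]

/-- A solution of the differential equation `t df/dt = X f`, where `X = O(t)`, is determined by its
constant term. -/
theorem eq_zero_of_euler_eq {N : ℕ} {X : Module.End ℚ (Trunc N)} (hX : X ∈ tOrder N 1)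
    {f : Trunc N} (h : euler N f = X f) (h0 : f 0 = 0) : f = 0 := by
  have key : ∀ a : ℕ, f ∈ filt N 1 0 ((a + 1 : ℕ) : ℤ) := by
    intro a
    induction a with
    | zero =>
      intro j ρ hj
      have : j = 0 := Fin.ext (by
        simp only [one_mul, AddMonoidHom.zero_apply, add_zero] at hj
        rw [Fin.val_zero]
        omega)
      rw [this, h0, map_zero]
    | succ a ih =>
      intro j ρ hj
      simp only [one_mul, AddMonoidHom.zero_apply, add_zero] at hj
      rcases lt_or_ge (j : ℕ) (a + 1) with h1 | h1
      · exact ih j ρ (by simp only [one_mul, AddMonoidHom.zero_apply, add_zero]; omega)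
      · have h2 := hX _ _ ih j ρ (by
          simp only [one_mul, AddMonoidHom.zero_apply, add_zero]; omega)
        rw [← h, euler_apply, map_smul, smul_eq_mul] at h2
        have h3 : ((j : ℕ) : ℚ) ≠ 0 := by
          have : (j : ℕ) ≠ 0 := by omega
          exact_mod_cast this
        exact (mul_eq_zero.1 h2).resolve_left h3
  refine funext fun j => TorusLie.ext_coef fun ρ => ?_
  rw [key N j ρ (by simp only [one_mul, AddMonoidHom.zero_apply, add_zero]; omega)]
  simp

theorem ksLog_monomial (N d i : ℕ) (c ν : Charge) : ksLog N d c (monomial N i ν) =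
    ∑ k ∈ Finset.Icc 1 N,
      (1 / (k : ℚ) ^ 2 * coeff (k • c) ν) • monomial N (i + k * d) (ν + k • c) := by
  simp only [ksLog, LinearMap.sum_apply, LinearMap.smul_apply, tAd_monomial, smul_smul]

theorem ksPow_monomial_of_pairing_eq_zero (N : ℕ) {d : ℕ} (hd : 1 ≤ d) (i : ℕ) {γ ν : Charge}
    (h : pairing γ ν = 0) (c : ℚ) : ksPow N d γ c (monomial N i ν) = monomial N i ν := by
  refine exp_apply_of_apply_eq_zero (isNilpotent_smul_ksLog N hd γ c) ?_
  rw [LinearMap.smul_apply, ksLog_monomial, Finset.sum_eq_zero, smul_zero]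
  intro k _
  rw [coeff, pairing_nsmul_left, h]
  simp

theorem delta_ksLog_monomial (N : ℕ) (i : ℕ) (γ ν : Charge) :
    delta N (ksLog N 1 γ) (monomial N i ν) = ∑ k ∈ Finset.Icc 1 N,
      ((-1) ^ ((k : ℤ) * pairing γ ν) * (pairing γ ν : ℚ)) • monomial N (i + k) (ν + k • γ) := by
  rw [ksLog, map_sum, LinearMap.sum_apply]
  refine Finset.sum_congr rfl fun k hk => ?_
  have hk0 : (k : ℚ) ≠ 0 := by
    have := (Finset.mem_Icc.1 hk).1
    exact_mod_cast (by omega : k ≠ 0)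
  rw [map_smul, delta_tMul, LinearMap.smul_apply, LinearMap.smul_apply, tAd_monomial, smul_smul,
    smul_smul, mul_one, coeff, pairing_nsmul_left]
  congr 1
  push_cast
  field_simp

/-- If `c ⟨γ,μ⟩ = -1`, then `𝒦_γ^c` maps `e_μ` to the binomial `e_μ + t e_{μ+γ}`. -/
theorem ksPow_monomial_of_mul_pairing (N : ℕ) {γ μ : Charge} {c : ℚ}
    (h : c * pairing γ μ = -1) (hodd : (-1 : ℚ) ^ pairing γ μ = -1) :
    ksPow N 1 γ c (monomial N 0 μ) = monomial N 0 μ + monomial N 1 (μ + γ) := by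
  have hn := isNilpotent_smul_ksLog N le_rfl γ c
  have hX : c • delta N (ksLog N 1 γ) ∈ tOrder N 1 := by
    refine Submodule.smul_mem _ _ ?_
    rw [ksLog, map_sum]
    refine Submodule.sum_mem _ fun k hk => ?_
    have := (Finset.mem_Icc.1 hk).1
    rw [map_smul, delta_tMul]
    refine Submodule.smul_mem _ _ (Submodule.smul_mem _ _ ?_)
    exact raising_antitone (by push_cast; omega) (tAd_mem_tOrder N _ _)
  have hsign : ∀ k : ℕ, (-1 : ℚ) ^ ((k : ℤ) * pairing γ μ) = (-1) ^ k := fun k => by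
    rw [mul_comm, zpow_mul, hodd, zpow_natCast]
  have hE : ∀ i ν, euler N (monomial N i ν) = (i : ℚ) • monomial N i ν := by
    intro i ν
    funext j
    rw [euler_apply, Pi.smul_apply, monomial]
    split_ifs with hj
    · rw [hj]
    · simp
  -- both sides solve the equation `t df/dt = c δ(log 𝒦_γ) f` and have the same constant term
  rw [← sub_eq_zero]
  refine eq_zero_of_euler_eq hX ?_ ?_
  · have e1 : euler N (ksPow N 1 γ c (monomial N 0 μ)) =
        (c • delta N (ksLog N 1 γ)) (ksPow N 1 γ c (monomial N 0 μ)) := by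
      have h1 := LinearMap.congr_fun (delta_ksPow N le_rfl γ c) (monomial N 0 μ)
      have h2 : Commute (ksPow N 1 γ c) (c • delta N (ksLog N 1 γ)) :=
        commute_exp (((commute_ksLog_delta N 1 γ).smul_left c).smul_right c)
      rw [h2.eq, delta_apply, LinearMap.sub_apply, Module.End.mul_apply, Module.End.mul_apply,
        Module.End.mul_apply, hE, Nat.cast_zero, zero_smul, map_zero, sub_zero] at h1
      exact h1
    have e2 : (c • delta N (ksLog N 1 γ)) (monomial N 0 μ + monomial N 1 (μ + γ)) =
        monomial N 1 (μ + γ) := by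
      rw [LinearMap.smul_apply, map_add, delta_ksLog_monomial, delta_ksLog_monomial,
        ← Finset.sum_add_distrib, Finset.smul_sum]
      have hp : pairing γ (μ + γ) = pairing γ μ := by rw [pairing_add_right, pairing_self, add_zero]
      -- the sum telescopes, and the remaining term lies beyond the truncation
      have h3 : ∀ n : ℕ, ∑ k ∈ Finset.Icc 1 n,
          c • (((-1) ^ ((k : ℤ) * pairing γ μ) * (pairing γ μ : ℚ)) •
              monomial N (0 + k) (μ + k • γ) +
            ((-1) ^ ((k : ℤ) * pairing γ (μ + γ)) * (pairing γ (μ + γ) : ℚ)) •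
              monomial N (1 + k) (μ + γ + k • γ)) =
          monomial N 1 (μ + γ) - (-1 : ℚ) ^ n • monomial N (n + 1) (μ + (n + 1) • γ) := by
        intro n
        induction n with
        | zero => simp
        | succ n ih =>
          rw [Finset.sum_Icc_succ_top (by omega), ih, hp, hsign, smul_add, smul_smul, smul_smul,
            show c * ((-1) ^ (n + 1) * (pairing γ μ : ℚ)) = (-1) ^ (n + 1) * (c * pairing γ μ) by
              ring,
            h, zero_add, add_comm 1 (n + 1),
            show μ + γ + (n + 1) • γ = μ + (n + 1 + 1) • γ by
              rw [add_smul (n + 1) 1, one_smul]; abel,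
            pow_succ]
          module
      rw [h3, monomial_of_lt (Nat.lt_succ_self N), smul_zero, sub_zero]
    rw [map_sub, map_sub, e1, e2, map_add, hE, hE, Nat.cast_zero, zero_smul, zero_add, Nat.cast_one,
      one_smul]
  · have h1 : ksPow N 1 γ c - 1 ∈ tOrder N 1 :=
      ksPow_sub_one_mem_raising le_rfl _ _ zero_le_one (by simp)
    refine TorusLie.ext_coef fun ρ => ?_
    have h2 := h1 0 (monomial N 0 μ) (by simpa using monomial_mem_filt N 1 0 0 μ) 0 ρ (by simp)
    rw [LinearMap.sub_apply, Module.End.one_apply, Pi.sub_apply, map_sub] at h2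
    rw [Pi.sub_apply, Pi.add_apply, map_sub, map_add, coef_monomial N 1, if_neg (by simp),
      add_zero, h2, map_zero]

/-! ### Two occupied states -/

theorem filter_rayList_twoStates {N : ℕ} (hN : 1 ≤ N) :
    (rayList N).filter (fun p => decide (p = (1, 0) ∨ p = (0, 1))) = [(1, 0), (0, 1)] := by
  have hnd : ((rayList N).filter (fun p => decide (p = (1, 0) ∨ p = (0, 1)))).Nodup :=
    (nodup_rayList N).filter _
  refine (((List.perm_ext_iff_of_nodup hnd (by simp)).2 fun p => ?_).eq_of_pairwise
    (fun _ _ _ _ hab hba => absurd hab (lt_asymm hba)) ((isOrderedRays_rayList N).2.filter _)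
    (by simp))
  rw [List.mem_filter, mem_rayList, decide_eq_true_eq]
  simp only [List.mem_cons, List.not_mem_nil, or_false, and_iff_right_iff_imp]
  rintro (rfl | rfl) <;> simp [hN]

theorem rayElement_eq_ksPow {N : ℕ} (hN : 1 ≤ N) {γ γ' : Charge} {Ω : Charge → ℚ} {p : ℕ × ℕ}
    (h : ∀ i, 1 ≤ i → Ω ((i + 1) • (p.1 • γ + p.2 • γ')) = 0) :
    rayElement N γ γ' Ω p =
      ksPow N (p.1 + p.2) (p.1 • γ + p.2 • γ') (Ω (p.1 • γ + p.2 • γ')) := by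
  obtain ⟨n, rfl⟩ : ∃ n, N = n + 1 := ⟨N - 1, by omega⟩
  unfold rayElement
  rw [List.range_succ_eq_map, List.map_cons, List.prod_cons, List.map_map, zero_add, one_mul,
    one_smul]
  rw [List.prod_eq_one, mul_one]
  intro A hA
  obtain ⟨i, _, rfl⟩ := List.mem_map.1 hA
  simp only [Function.comp_apply]
  rw [h _ (Nat.succ_pos i), ksPow_zero]

/-- If only `γ` and `γ'` are occupied, the ordered product is `𝒦_γ 𝒦_γ'`. -/
theorem prod_twoStates {γ γ' : Charge} (hp : pairing γ γ' ≠ 0) {N : ℕ} (hN : 1 ≤ N) :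
    ((rayList N).map (rayElement N γ γ' (twoStates γ γ'))).prod =
      ksPow N 1 γ 1 * ksPow N 1 γ' 1 := by
  have hne : ∀ m l : ℕ, ¬ (m = 1 ∧ l = 0) → ¬ (m = 0 ∧ l = 1) →
      twoStates γ γ' (m • γ + l • γ') = 0 := by
    intro m l h1 h2
    refine if_neg ?_
    rintro (h | h)
    · exact h1 (eq_of_ray_eq hp (m' := 1) (l' := 0) (by rw [h]; simp))
    · exact h2 (eq_of_ray_eq hp (m' := 0) (l' := 1) (by rw [h]; simp))
  rw [← list_prod_filter_of_eq_one _ (fun p => decide (p = (1, 0) ∨ p = (0, 1))),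
    filter_rayList_twoStates hN]
  · rw [List.map_cons, List.map_cons, List.map_nil, List.prod_cons, List.prod_cons, List.prod_nil,
      mul_one, rayElement_eq_ksPow hN, rayElement_eq_ksPow hN]
    · simp [twoStates]
    · intro i hi
      rw [succ_nsmul_ray]
      exact hne _ _ (by simp) (by simp; omega)
    · intro i hi
      rw [succ_nsmul_ray]
      exact hne _ _ (by simp; omega) (by simp)
  · intro p hpL h
    refine List.prod_eq_one fun A hA => ?_
    obtain ⟨i, _, rfl⟩ := List.mem_map.1 hA
    have h1 : ¬ (p = (1, 0) ∨ p = (0, 1)) := by simpa using h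
    rw [succ_nsmul_ray, hne, ksPow_zero]
    · rintro ⟨h2, h3⟩
      have h4 := Nat.eq_one_of_mul_eq_one_left h2
      have h5 : p.2 = 0 := by simpa using h3
      exact h1 (Or.inl (Prod.ext h4 h5))
    · rintro ⟨h2, h3⟩
      have h4 := Nat.eq_one_of_mul_eq_one_left h3
      have h5 : p.1 = 0 := by simpa using h2
      exact h1 (Or.inr (Prod.ext h5 h4))

/-! ### The Gauss decomposition with respect to the level -/

/-- The level of `ρ`: along the cone it grows by `-⟨γ,γ'⟩ (l - m)` upon adding `m γ + l γ'`. -/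
def level (γ γ' : Charge) : Charge →+ ℤ where
  toFun ρ := -pairing (γ + γ') ρ
  map_zero' := by simp [pairing]
  map_add' a b := by rw [pairing_add_right]; ring

theorem level_apply (γ γ' ρ : Charge) : level γ γ' ρ = -pairing (γ + γ') ρ := rfl

theorem level_ray {γ γ' : Charge} (hp : pairing γ γ' = -2) (m l : ℕ) :
    level γ γ' (m • γ + l • γ') = 2 * ((l : ℤ) - m) := by
  simp only [level_apply, pairing_add_left, pairing_add_right, pairing_nsmul_right, pairing_self,
    pairing_swap γ' γ, hp]
  ring

/-- `U⁻¹ = 1 - Y` up to operators raising the weight by `4` or more, where `Y` raises the weight by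
`2` or more. A left inverse `V` of `U` is all that is asked for. -/
def InverseApprox (N : ℕ) (wt : Charge →+ ℤ) (U Y : Module.End ℚ (Trunc N)) : Prop :=
  ∃ V, V * U = 1 ∧ V - 1 + Y ∈ raising N 0 wt 4 ∧ Y ∈ raising N 0 wt 2

section gauss

variable {N : ℕ} {wt : Charge →+ ℤ}

theorem InverseApprox.mul {U U' Y Y' : Module.End ℚ (Trunc N)} (h : InverseApprox N wt U Y)
    (h' : InverseApprox N wt U' Y') : InverseApprox N wt (U * U') (Y + Y') := by
  obtain ⟨V, h1, h2, h3⟩ := h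
  obtain ⟨V', h1', h2', h3'⟩ := h'
  refine ⟨V' * V, ?_, ?_, Submodule.add_mem _ h3 h3'⟩
  · rw [mul_assoc, ← mul_assoc V, h1, one_mul, h1']
  · have hV : ∀ W Z : Module.End ℚ (Trunc N), W - 1 + Z ∈ raising N 0 wt 4 →
        Z ∈ raising N 0 wt 2 → W - 1 ∈ raising N 0 wt 2 := fun W Z hW hZ => by
      have := Submodule.sub_mem _ (raising_antitone (by norm_num : (2 : ℤ) ≤ 4) hW) hZ
      rwa [add_sub_cancel_right] at this
    have e : V' * V - 1 + (Y + Y') = (V' - 1) * (V - 1) + (V - 1 + Y) + (V' - 1 + Y') := by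
      rw [mul_sub_one_eq]; abel
    rw [e]
    have h4 : (V' - 1) * (V - 1) ∈ raising N 0 wt 4 :=
      raising_antitone (by norm_num) (mul_mem_raising (hV V' Y' h2' h3') (hV V Y h2 h3))
    exact Submodule.add_mem _ (Submodule.add_mem _ h4 h2) h2'

theorem InverseApprox.list_prod {ι : Type*} (f g : ι → Module.End ℚ (Trunc N)) (L : List ι)
    (h : ∀ i ∈ L, InverseApprox N wt (f i) (g i)) :
    InverseApprox N wt (L.map f).prod (L.map g).sum := by
  induction L with
  | nil => exact ⟨1, by simp, by simp, by simp⟩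
  | cons a L ih =>
    rw [List.map_cons, List.map_cons, List.prod_cons, List.sum_cons]
    exact (h a (by simp)).mul (ih fun i hi => h i (by simp [hi]))

theorem inverseApprox_ksPow {d : ℕ} (hd : 1 ≤ d) {μ : Charge} (h : 2 ≤ wt μ) (c : ℚ) :
    InverseApprox N wt (ksPow N d μ c) (c • ksLog N d μ) := by
  have hY : c • ksLog N d μ ∈ raising N 0 wt 2 :=
    Submodule.smul_mem _ _ (ksLog_mem_raising d μ (by norm_num) (by linarith))
  refine ⟨ksPow N d μ (-c), ksPow_neg_mul N hd μ c, ?_, hY⟩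
  have := exp_sub_one_sub_mem_raising (by norm_num) (Submodule.neg_mem _ hY)
    (isNilpotent_smul_ksLog N hd μ c).neg
  rw [sub_neg_eq_add] at this
  rw [ksPow, neg_smul]
  exact this

/-- The logarithm `∑_k Ω(kμ) log 𝒦_{kμ}` of `𝕊(ℓ)`, whose factors commute. -/
def rayLog (N : ℕ) (γ γ' : Charge) (Ω : Charge → ℚ) (p : ℕ × ℕ) : Module.End ℚ (Trunc N) :=
  ((List.range N).map fun i => Ω (((i + 1) * p.1) • γ + ((i + 1) * p.2) • γ') •
    ksLog N ((i + 1) * p.1 + (i + 1) * p.2) (((i + 1) * p.1) • γ + ((i + 1) * p.2) • γ')).sum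

theorem inverseApprox_rayElement {γ γ' : Charge} (hp : pairing γ γ' = -2) (Ω : Charge → ℚ)
    {p : ℕ × ℕ} (h : p.1 < p.2) :
    InverseApprox N (level γ γ') (rayElement N γ γ' Ω p) (rayLog N γ γ' Ω p) := by
  refine InverseApprox.list_prod _ _ _ fun i _ => ?_
  rw [succ_nsmul_ray, mul_add]
  refine inverseApprox_ksPow (by rw [← mul_add]; exact Nat.mul_pos (Nat.succ_pos i) (by omega)) ?_ _
  rw [level_ray hp]
  push_cast
  have h1 : (p.1 : ℤ) + 1 ≤ p.2 := by exact_mod_cast h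
  nlinarith [Nat.cast_nonneg (α := ℤ) i]

end gauss

/-- A list ordered by `r` splits along a predicate that is inherited by predecessors. -/
theorem filter_append_filter_not {α : Type*} {r : α → α → Prop} (P : α → Bool) {L : List α}
    (hL : L.Pairwise r) (h : ∀ a b, r a b → P b = true → P a = true) :
    L = L.filter P ++ L.filter fun a => !P a := by
  induction L with
  | nil => rfl
  | cons a L ih =>
    obtain ⟨h1, h2⟩ := List.pairwise_cons.1 hL
    cases hP : P a with
    | true => rw [List.filter_cons_of_pos hP, List.filter_cons_of_neg (by simp [hP]),
        List.cons_append, ← ih h2]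
    | false =>
      have hnone : L.filter P = [] := List.filter_eq_nil_iff.2 fun b hb hPb => by
        rw [h a b (h1 b hb) hPb] at hP
        exact Bool.noConfusion hP
      have := ih h2
      rw [List.filter_cons_of_neg (by simp [hP]), List.filter_cons_of_pos (by simp [hP]), hnone,
        List.nil_append]
      rw [hnone, List.nil_append] at this
      rw [← this]

/-- The translation `e_ν ↦ e_{ν+η}` of `𝔤`. -/
def translate (η : Charge) : Module.End ℚ TorusLie := Finsupp.lmapDomain ℚ ℚ fun ν => ν + η

theorem translate_e (η ν : Charge) : translate η (e ν) = e (ν + η) := Finsupp.mapDomain_single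

theorem coef_translate (η ρ : Charge) (x : TorusLie) :
    coef (ρ + η) (translate η x) = coef ρ x :=
  Finsupp.mapDomain_apply (add_left_injective η) x ρ

theorem commute_ad_translate {c η : Charge} (h : pairing c η = 0) :
    Commute (LieAlgebra.ad ℚ TorusLie (e c)) (translate η) := by
  refine LinearMap.ext fun x => ?_
  induction x using TorusLie.induction with
  | h0 => simp
  | hadd x y hx hy => rw [map_add, map_add, hx, hy]
  | he a ν =>
    rw [map_smul, map_smul]
    congr 1
    simp only [Module.End.mul_apply, translate_e, LieAlgebra.ad_apply, lie_e, map_smul, add_assoc]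
    rw [coeff, coeff, pairing_add_right, h, add_zero]

theorem commute_ksPow_translate (N d e : ℕ) {c η : Charge} (h : pairing c η = 0) (a : ℚ) :
    Commute (ksPow N d c a) (tMul N e (translate η)) := by
  refine commute_exp (Commute.smul_left ?_ a)
  refine Commute.sum_left _ _ _ fun k _ => Commute.smul_left ?_ _
  have h1 : Commute (LieAlgebra.ad ℚ TorusLie (SU3.e (k • c))) (translate η) :=
    commute_ad_translate (by rw [pairing_nsmul_left, h, mul_zero])
  show _ * _ = _ * _
  rw [tMul_mul, tMul_mul, h1.eq, add_comm (k * d)]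

theorem commute_list_prod {M : Type*} [Monoid M] (L : List M) (b : M) (h : ∀ a ∈ L, Commute a b) :
    Commute L.prod b := by
  induction L with
  | nil => exact Commute.one_left b
  | cons a L ih =>
    rw [List.prod_cons]
    exact (h a (by simp)).mul_left (ih fun x hx => h x (by simp [hx]))

theorem tMul_translate_monomial (N d i : ℕ) (η ν : Charge) :
    tMul N d (translate η) (monomial N i ν) = monomial N (i + d) (ν + η) := by
  funext j
  rw [tMul_apply]
  simp only [monomial]
  by_cases h : (j : ℕ) = i + d
  · rw [if_pos (by omega), if_pos (by omega), if_pos h, translate_e]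
  · rw [if_neg h]
    split_ifs <;> first | rfl | omega

/-- The coefficient of `t^j e_ρ` in the image of `f`. -/
def matrixCoef (N : ℕ) (f : Trunc N) (j : Fin (N + 1)) (ρ : Charge) :
    Module.End ℚ (Trunc N) →ₗ[ℚ] ℚ :=
  (coef ρ ∘ₗ LinearMap.proj j) ∘ₗ LinearMap.applyₗ f

theorem matrixCoef_apply (N : ℕ) (f : Trunc N) (j : Fin (N + 1)) (ρ : Charge)
    (A : Module.End ℚ (Trunc N)) : matrixCoef N f j ρ A = coef ρ (A f j) := rfl

section kronecker

variable {N : ℕ} {γ γ' : Charge}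

/-- Among all `log 𝒦_{mγ+lγ'}`, only the one with `(m, l) = (k, k + 1)` has a term of charge
`k γ + (k+1) γ'`, because `k` and `k + 1` are coprime. -/
theorem matrixCoef_ksLog (hp : pairing γ γ' ≠ 0) {i k : ℕ} (hN : i + (2 * k + 1) ≤ N)
    (ν : Charge) (m l : ℕ) :
    matrixCoef N (monomial N i ν) ⟨i + (2 * k + 1), by omega⟩ (ν + (k • γ + (k + 1) • γ'))
      (ksLog N (m + l) (m • γ + l • γ')) =
        if m = k ∧ l = k + 1 then coeff (k • γ + (k + 1) • γ') ν else 0 := by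
  rw [matrixCoef_apply, ksLog_monomial, Finset.sum_apply, map_sum]
  have hterm : ∀ c : ℕ, ν + c • (m • γ + l • γ') = ν + (k • γ + (k + 1) • γ') ↔
      c * m = k ∧ c * l = k + 1 := by
    intro c
    rw [add_right_inj, smul_add, smul_smul, smul_smul]
    constructor
    · exact fun h => eq_of_ray_eq hp h
    · rintro ⟨h1, h2⟩
      rw [h1, h2]
  have hone : ∀ c : ℕ, c * m = k ∧ c * l = k + 1 → c = 1 := by
    rintro c ⟨h1, h2⟩
    have h3 : c ∣ 1 := (Nat.dvd_add_right (Dvd.intro m h1)).1 (Dvd.intro l h2)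
    exact Nat.dvd_one.1 h3
  split_ifs with h
  · obtain ⟨rfl, rfl⟩ := h
    rw [Finset.sum_eq_single 1]
    · rw [Pi.smul_apply, map_smul, coef_monomial, if_pos]
      · simp
      · refine ⟨by simp only; omega, by rw [one_smul]⟩
    · intro c _ hc
      rw [Pi.smul_apply, map_smul, coef_monomial, if_neg, smul_zero]
      exact fun h => hc (hone c ((hterm c).1 h.2))
    · intro h1
      simp only [Finset.mem_Icc] at h1
      omega
  · refine Finset.sum_eq_zero fun c _ => ?_
    rw [Pi.smul_apply, map_smul, coef_monomial, if_neg, smul_zero]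
    rintro ⟨-, h2⟩
    have h3 := (hterm c).1 h2
    have h4 := hone c h3
    rw [h4, one_mul, one_mul] at h3
    exact h h3

theorem matrixCoef_sum_rayLog (hp : pairing γ γ' ≠ 0) {i k : ℕ} (hN : i + (2 * k + 1) ≤ N)
    (ν : Charge) (Ω : Charge → ℚ) {L : List (ℕ × ℕ)} (hL : L.Nodup)
    (hk : (k, k + 1) ∈ L) :
    matrixCoef N (monomial N i ν) ⟨i + (2 * k + 1), by omega⟩ (ν + (k • γ + (k + 1) • γ'))
      (L.map (rayLog N γ γ' Ω)).sum =
        Ω (k • γ + (k + 1) • γ') * coeff (k • γ + (k + 1) • γ') ν := by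
  rw [map_list_sum, List.map_map, ← List.sum_toFinset _ hL]
  have hray : ∀ p : ℕ × ℕ, (matrixCoef N (monomial N i ν) ⟨i + (2 * k + 1), by omega⟩
      (ν + (k • γ + (k + 1) • γ')) ∘ rayLog N γ γ' Ω) p = ∑ i ∈ Finset.range N,
        Ω (((i + 1) * p.1) • γ + ((i + 1) * p.2) • γ') *
          if (i + 1) * p.1 = k ∧ (i + 1) * p.2 = k + 1 then coeff (k • γ + (k + 1) • γ') ν
          else 0 := by
    intro p
    rw [Function.comp_apply, rayLog, map_list_sum, List.map_map,
      ← List.sum_toFinset _ List.nodup_range, List.toFinset_range]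
    refine Finset.sum_congr rfl fun c _ => ?_
    rw [Function.comp_apply, map_smul, matrixCoef_ksLog hp hN, smul_eq_mul]
  have hone : ∀ c m l : ℕ, (c + 1) * m = k ∧ (c + 1) * l = k + 1 → c = 0 := by
    rintro c m l ⟨h1, h2⟩
    have h3 : c + 1 ∣ 1 := (Nat.dvd_add_right (Dvd.intro m h1)).1 (Dvd.intro l h2)
    have := Nat.dvd_one.1 h3
    omega
  simp only [hray]
  rw [Finset.sum_eq_single (k, k + 1)]
  · rw [Finset.sum_eq_single 0]
    · simp
    · intro c _ hc
      rw [if_neg fun h => hc (hone c _ _ h), mul_zero]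
    · intro h
      simp only [Finset.mem_range] at h
      omega
  · intro p _ hpk
    refine Finset.sum_eq_zero fun c _ => ?_
    rw [if_neg, mul_zero]
    intro h
    have h0 := hone c _ _ h
    rw [h0, zero_add, one_mul, one_mul] at h
    exact hpk (Prod.ext h.1 h.2)
  · intro h
    exact absurd (List.mem_toFinset.2 hk) h

end kronecker

/-! ### The spectrum of the wall crossing of two states with pairing `-2` -/

theorem matrixCoef_eq_zero_of_mem_filt {N : ℕ} {wt : Charge →+ ℤ} {a : ℤ} {f : Trunc N}
    (hf : f ∈ filt N 0 wt a) {j : Fin (N + 1)} {ρ : Charge} (h : wt ρ < a) : coef ρ (f j) = 0 :=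
  hf j ρ (by rwa [zero_mul, zero_add])

theorem mem_filt_monomial {N : ℕ} (wt : Charge →+ ℤ) (i : ℕ) (ν : Charge) :
    monomial N i ν ∈ filt N 0 wt (wt ν) := by
  simpa using monomial_mem_filt N 0 wt i ν

theorem coef_apply_monomial_of_mem_raising {N : ℕ} {wt : Charge →+ ℤ} {k : ℤ}
    {A : Module.End ℚ (Trunc N)} (hA : A ∈ raising N 0 wt k) {ν ρ : Charge} (h : wt ρ < wt ν + k)
    (i : ℕ) (j : Fin (N + 1)) : coef ρ (A (monomial N i ν) j) = 0 :=
  matrixCoef_eq_zero_of_mem_filt (hA _ _ (mem_filt_monomial wt i ν)) h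

/-- The factorisation of `𝒦_γ 𝒦_γ'` into the parts raising, preserving and lowering the level. Here
`V` is the inverse of the raising part and `1 - Y` its leading term, `U₀` preserves the level, and
`U` lowers it. The last clause says that the invariants of `k γ + (k+1) γ'` are the coefficients
of `Y`. The part `U₀` commutes with the translations by charges `η` orthogonal to `γ + γ'`. -/
theorem exists_gauss {γ γ' : Charge} (hp : pairing γ γ' = -2) {Ω : Charge → ℚ}
    (h : KSWCF γ γ' (twoStates γ γ') Ω) {N : ℕ} (hN : 1 ≤ N) :
    ∃ V Y U₀ U : Module.End ℚ (Trunc N),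
      V * (ksPow N 1 γ 1 * ksPow N 1 γ' 1) = U₀ * U ∧
      V - 1 + Y ∈ raising N 0 (level γ γ') 4 ∧ Y ∈ raising N 0 (level γ γ') 2 ∧
      U - 1 ∈ raising N 0 (-level γ γ') 2 ∧
      U₀ - 1 ∈ raising N 0 (-level γ γ') 0 ∧ U₀ - 1 ∈ tOrder N 1 ∧
      (∀ η e, pairing (γ + γ') η = 0 → Commute U₀ (tMul N e (translate η))) ∧
      ∀ i k : ℕ, ∀ hk : i + (2 * k + 1) ≤ N, ∀ ν,
        coef (ν + (k • γ + (k + 1) • γ')) (Y (monomial N i ν) ⟨i + (2 * k + 1), by omega⟩) =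
          Ω (k • γ + (k + 1) • γ') * coeff (k • γ + (k + 1) • γ') ν := by
  have hp0 : pairing γ γ' ≠ 0 := by rw [hp]; norm_num
  let L := (rayList N).reverse
  have hmem : ∀ p ∈ L, 1 ≤ p.1 + p.2 := fun p hp => one_le_of_mem_rayList (List.mem_reverse.1 hp)
  have hord : L.Pairwise fromSecond := by
    have := (isOrderedRays_rayList N).2
    exact List.pairwise_reverse.2 this
  -- the rays with `m < l`, with `m = l` and with `m > l`
  let L1 := L.filter fun p => decide (p.1 < p.2)
  let L2 := (L.filter fun p => !decide (p.1 < p.2)).filter fun p => decide (p.1 ≤ p.2)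
  let L3 := (L.filter fun p => !decide (p.1 < p.2)).filter fun p => !decide (p.1 ≤ p.2)
  have hsplit : L = L1 ++ (L2 ++ L3) := by
    have e1 : L = L1 ++ L.filter fun p => !decide (p.1 < p.2) := by
      refine filter_append_filter_not _ hord fun p q hpq hq => ?_
      simp only [decide_eq_true_eq, fromSecond] at hpq hq ⊢
      by_contra hcon
      nlinarith
    have e2 : L.filter (fun p => !decide (p.1 < p.2)) = L2 ++ L3 := by
      refine filter_append_filter_not _ (hord.filter _) fun p q hpq hq => ?_
      simp only [decide_eq_true_eq, fromSecond] at hpq hq ⊢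
      by_contra hcon
      nlinarith
    rw [← e2]
    exact e1
  have hprod := kswcf_iff.1 h N
  rw [prod_twoStates hp0 hN] at hprod
  change _ = (L.map _).prod at hprod
  rw [hsplit, List.map_append, List.map_append, List.prod_append, List.prod_append] at hprod
  obtain ⟨V, hV1, hV2, hV3⟩ := InverseApprox.list_prod (N := N) (wt := level γ γ')
    (rayElement N γ γ' Ω) (rayLog N γ γ' Ω) L1 fun p hpL => by
      have := (List.mem_filter.1 hpL).2
      exact inverseApprox_rayElement hp Ω (by simpa using this)
  have hL2 : ∀ p ∈ L2, 1 ≤ p.1 + p.2 ∧ p.1 = p.2 := by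
    intro p hpL
    obtain ⟨h1, h2⟩ := List.mem_filter.1 hpL
    obtain ⟨h3, h4⟩ := List.mem_filter.1 h1
    simp only [Bool.not_eq_true', decide_eq_false_iff_not, decide_eq_true_eq] at h2 h4
    exact ⟨hmem p h3, by omega⟩
  refine ⟨V, (L1.map (rayLog N γ γ' Ω)).sum, (L2.map (rayElement N γ γ' Ω)).prod,
    (L3.map (rayElement N γ γ' Ω)).prod, ?_, hV2, hV3, ?_, ?_, ?_, ?_, ?_⟩
  · rw [hprod, ← mul_assoc, hV1, one_mul]
  · refine list_prod_sub_one_mem_raising (by norm_num) _ fun A hA => ?_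
    obtain ⟨p, hpL, rfl⟩ := List.mem_map.1 hA
    obtain ⟨h1, h2⟩ := List.mem_filter.1 hpL
    simp only [Bool.not_eq_true', decide_eq_false_iff_not] at h2
    refine rayElement_sub_one_mem_raising (hmem p (List.mem_filter.1 h1).1) (by norm_num) ?_
    rw [AddMonoidHom.neg_apply, level_ray hp]
    omega
  · refine list_prod_sub_one_mem_raising (by norm_num) _ fun A hA => ?_
    obtain ⟨p, hpL, rfl⟩ := List.mem_map.1 hA
    refine rayElement_sub_one_mem_raising (hL2 p hpL).1 (by norm_num) ?_
    rw [AddMonoidHom.neg_apply, level_ray hp, (hL2 p hpL).2]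
    omega
  · refine list_prod_sub_one_mem_raising (by norm_num) _ fun A hA => ?_
    obtain ⟨p, hpL, rfl⟩ := List.mem_map.1 hA
    exact rayElement_sub_one_mem_tOrder (hL2 p hpL).1
  · intro η e hη
    refine commute_list_prod _ _ fun A hA => ?_
    obtain ⟨p, hpL, rfl⟩ := List.mem_map.1 hA
    refine commute_list_prod _ _ fun A hA => ?_
    obtain ⟨i, _, rfl⟩ := List.mem_map.1 hA
    refine commute_ksPow_translate N _ _ ?_ _
    rw [(hL2 p hpL).2, ← smul_add, pairing_nsmul_left, pairing_nsmul_left, hη, mul_zero, mul_zero]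
  · intro i k hk ν
    rw [← matrixCoef_apply]
    refine matrixCoef_sum_rayLog hp0 hk ν Ω ?_ ?_
    · exact (List.nodup_reverse.2 (nodup_rayList N)).filter _
    · refine List.mem_filter.2 ⟨List.mem_reverse.2 (mem_rayList.2 ⟨?_, ?_⟩), ?_⟩
      · simp
      · simp only; omega
      · simp

/-- The dyons of an `SU(2)` wall crossing: if only `γ`, `γ'` with `⟨γ,γ'⟩ = -2` are occupied, then
on the other side all charges `k γ + (k+1) γ'` have invariant `1`. The auxiliary charges `μ`, `μ'`
are dual to `γ`, `γ'` up to sign. -/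
theorem KSWCF.apply_dyon {γ γ' : Charge} (hp : pairing γ γ' = -2) {μ μ' : Charge}
    (h1 : pairing γ μ = -1) (h2 : pairing γ' μ = 0) (h3 : pairing γ μ' = 0)
    (h4 : pairing γ' μ' = 1) {Ω : Charge → ℚ} (h : KSWCF γ γ' (twoStates γ γ') Ω) (k : ℕ) :
    Ω (k • γ + (k + 1) • γ') = 1 := by
  have hp' : pairing γ' γ = 2 := by rw [pairing_swap, hp]; norm_num
  -- the degree of `k γ + (k+1) γ'`
  obtain ⟨N, hN⟩ : ∃ N, N = 2 * k + 1 := ⟨_, rfl⟩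
  obtain ⟨V, Y, U₀, U, hVT, hV, hY, hU, hU₀, hU₀t, hcomm, hcoef⟩ :=
    exists_gauss hp h (N := N) (by omega)
  have hlev : ∀ ρ (m l : ℕ), level γ γ' (ρ + (m • γ + l • γ')) = level γ γ' ρ + 2 * ((l : ℤ) - m) :=
    fun ρ m l => by rw [map_add, level_ray hp]
  have hU₀' : U₀ ∈ raising N 0 (-level γ γ') 0 := by
    have := Submodule.add_mem _ hU₀ one_mem_raising
    rwa [sub_add_cancel] at this
  have hV1 : V - 1 ∈ raising N 0 (level γ γ') 2 := by
    have := Submodule.sub_mem _ (raising_antitone (by norm_num : (2 : ℤ) ≤ 4) hV) hY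
    rwa [add_sub_cancel_right] at this
  -- the action of `U₀` on `e_μ`, in the coefficient of `t^{2k} e_{μ + k (γ + γ')}`
  let c : ∀ k : ℕ, 2 * k ≤ N → ℚ := fun k hk =>
    coef (μ + (k • γ + k • γ')) (U₀ (monomial N 0 μ) ⟨2 * k, by omega⟩)
  have hc0 : c 0 (by omega) = 1 := by
    have := hU₀t 0 (monomial N 0 μ) (by simpa using monomial_mem_filt N 1 0 0 μ) 0 μ (by simp)
    rw [LinearMap.sub_apply, Pi.sub_apply, map_sub, sub_eq_zero, Module.End.one_apply,
      coef_monomial, if_pos (by simp)] at this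
    simpa [c] using this
  have hVlead : ∀ i k : ℕ, ∀ hk : i + (2 * k + 1) ≤ N, ∀ ν,
      coef (ν + (k • γ + (k + 1) • γ')) (V (monomial N i ν) ⟨i + (2 * k + 1), by omega⟩) =
        -(Ω (k • γ + (k + 1) • γ') * coeff (k • γ + (k + 1) • γ') ν) := by
    intro i k hk ν
    have e : V = 1 - Y + (V - 1 + Y) := by abel
    have h0 : coef (ν + (k • γ + (k + 1) • γ')) ((V - 1 + Y) (monomial N i ν)
        ⟨i + (2 * k + 1), by omega⟩) = 0 := by
      refine coef_apply_monomial_of_mem_raising hV ?_ _ _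
      rw [hlev]
      push_cast
      linarith
    rw [e, LinearMap.add_apply, Pi.add_apply, map_add, h0, add_zero, LinearMap.sub_apply,
      Pi.sub_apply, map_sub, hcoef i k hk ν, Module.End.one_apply, coef_monomial, if_neg, zero_sub]
    rintro ⟨h, -⟩
    simp only at h
    omega
  have hU₀U : ∀ i ν ρ (j : Fin (N + 1)), level γ γ' ν - 2 < level γ γ' ρ →
      coef ρ ((U₀ * U) (monomial N i ν) j) = coef ρ (U₀ (monomial N i ν) j) := by
    intro i ν ρ j hρ
    have e : U₀ * U = U₀ + U₀ * (U - 1) := by rw [mul_sub, mul_one]; abel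
    rw [e, LinearMap.add_apply, Pi.add_apply, map_add, add_eq_left]
    refine coef_apply_monomial_of_mem_raising (mul_mem_raising hU₀' hU) ?_ _ _
    simp only [AddMonoidHom.neg_apply]
    linarith
  -- the Gauss decomposition applied to `e_μ`, in the level of `e_μ`
  have eq1 : ∀ k : ℕ, ∀ hk : 2 * (k + 1) ≤ N,
      c (k + 1) hk = -(Ω (k • γ + (k + 1) • γ') * ((-1) ^ k * (k + 2))) := by
    intro k hk
    have hT : (ksPow N 1 γ 1 * ksPow N 1 γ' 1) (monomial N 0 μ) =
        monomial N 0 μ + monomial N 1 (μ + γ) := by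
      rw [Module.End.mul_apply, ksPow_monomial_of_pairing_eq_zero N le_rfl 0 h2,
        ksPow_monomial_of_mul_pairing N (by rw [h1]; norm_num) (by rw [h1]; norm_num)]
    have h5 := LinearMap.congr_fun hVT (monomial N 0 μ)
    rw [Module.End.mul_apply, hT, map_add] at h5
    have h6 := congrArg (fun f : Trunc N =>
      coef (μ + ((k + 1) • γ + (k + 1) • γ')) (f ⟨2 * (k + 1), by omega⟩)) h5
    have h7 : coef (μ + ((k + 1) • γ + (k + 1) • γ'))
        (V (monomial N 0 μ) ⟨2 * (k + 1), by omega⟩) = 0 := by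
      have e : V = 1 + (V - 1) := by abel
      rw [e, LinearMap.add_apply, Pi.add_apply, map_add,
        coef_apply_monomial_of_mem_raising hV1 (by rw [hlev]; simp), Module.End.one_apply,
        coef_monomial, if_neg (by simp), add_zero]
    have h8 := hVlead 1 k (by omega) (μ + γ)
    have hρ : μ + γ + (k • γ + (k + 1) • γ') = μ + ((k + 1) • γ + (k + 1) • γ') := by
      rw [add_smul k 1 γ, one_smul]; abel
    have hj : (⟨1 + (2 * k + 1), by omega⟩ : Fin (N + 1)) = ⟨2 * (k + 1), by omega⟩ :=
      Fin.ext (by simp only; omega)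
    have hcf : coeff (k • γ + (k + 1) • γ') (μ + γ) = (-1) ^ k * (k + 2) := by
      have : pairing (k • γ + (k + 1) • γ') (μ + γ) = ((k + 2 : ℕ) : ℤ) := by
        simp only [pairing_add_left, pairing_add_right, pairing_nsmul_left, pairing_self, h1, h2,
          hp']
        push_cast
        ring
      rw [coeff, this, zpow_natCast, pow_add]
      push_cast
      ring
    rw [hρ, hj, hcf] at h8
    simp only [Pi.add_apply, map_add] at h6
    rw [h7, h8, zero_add, hU₀U _ _ _ _ (by rw [hlev]; simp)] at h6
    exact h6.symm
  -- the Gauss decomposition applied to `e_μ' + t e_{μ'+γ'}`, in the level of the second term;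
  -- `𝒦_γ'` takes this vector to `e_μ'`
  have eq2 : ∀ k : ℕ, ∀ hk : 2 * k + 1 ≤ N,
      c k (by omega) = Ω (k • γ + (k + 1) • γ') * ((-1) ^ k * (k + 1)) := by
    intro k hk
    have hK' : ksPow N 1 γ' 1 (monomial N 0 μ' + monomial N 1 (μ' + γ')) = monomial N 0 μ' := by
      rw [← ksPow_monomial_of_mul_pairing (c := -1) N (by rw [h4]; norm_num) (by rw [h4]; norm_num),
        ← Module.End.mul_apply, ksPow_mul_neg N le_rfl, Module.End.one_apply]
    have h5 := LinearMap.congr_fun hVT (monomial N 0 μ' + monomial N 1 (μ' + γ'))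
    rw [Module.End.mul_apply, Module.End.mul_apply, hK',
      ksPow_monomial_of_pairing_eq_zero N le_rfl 0 h3, map_add] at h5
    have h6 := congrArg (fun f : Trunc N =>
      coef (μ' + (k • γ + (k + 1) • γ')) (f ⟨2 * k + 1, by omega⟩)) h5
    have h8 := hVlead 0 k (by omega) μ'
    have hj : (⟨0 + (2 * k + 1), by omega⟩ : Fin (N + 1)) = ⟨2 * k + 1, by omega⟩ :=
      Fin.ext (by simp only; omega)
    have hcf : coeff (k • γ + (k + 1) • γ') μ' = -((-1) ^ k * (k + 1)) := by
      have : pairing (k • γ + (k + 1) • γ') μ' = ((k + 1 : ℕ) : ℤ) := by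
        simp only [pairing_add_left, pairing_nsmul_left, h3, h4]
        push_cast
        ring
      rw [coeff, this, zpow_natCast, pow_succ]
      push_cast
      ring
    rw [hj, hcf] at h8
    have h9 : coef (μ' + (k • γ + (k + 1) • γ'))
        ((U₀ * U) (monomial N 0 μ') ⟨2 * k + 1, by omega⟩) = 0 := by
      have hU1 : U ∈ raising N 0 (-level γ γ') 0 := by
        have := Submodule.add_mem _ (raising_antitone (by norm_num) hU) one_mem_raising
        rwa [sub_add_cancel] at this
      refine coef_apply_monomial_of_mem_raising (mul_mem_raising hU₀' hU1) ?_ _ _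
      rw [AddMonoidHom.neg_apply, AddMonoidHom.neg_apply, hlev]
      push_cast
      linarith
    -- `U₀` commutes with the translation that takes `e_μ` to `e_{μ' + γ'}`
    have hη : pairing (γ + γ') (μ' + γ' - μ) = 0 := by
      have : pairing (γ + γ') (μ' + γ') = pairing (γ + γ') (μ' + γ' - μ) + pairing (γ + γ') μ := by
        rw [← pairing_add_right, sub_add_cancel]
      simp only [pairing_add_left γ γ' (μ' + γ'), pairing_add_left γ γ' μ, pairing_add_right,
        pairing_self, h1, h2, h3, h4, hp] at this
      omega
    have h10 : coef (μ' + (k • γ + (k + 1) • γ'))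
        (U₀ (monomial N 1 (μ' + γ')) ⟨2 * k + 1, by omega⟩) = c k (by omega) := by
      have h11 : monomial N 1 (μ' + γ') =
          tMul N 1 (translate (μ' + γ' - μ)) (monomial N 0 μ) := by
        rw [tMul_translate_monomial, add_sub_cancel]
      have hρ : μ' + (k • γ + (k + 1) • γ') = μ + (k • γ + k • γ') + (μ' + γ' - μ) := by
        rw [add_smul k 1 γ', one_smul]; abel
      rw [h11, ← Module.End.mul_apply, (hcomm _ _ hη).eq, Module.End.mul_apply, tMul_apply,
        if_pos (by simp), hρ, coef_translate]
      rfl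
    have hl : level γ γ' (μ' + γ') = level γ γ' μ' + 2 := by
      simpa using hlev μ' 0 1
    simp only [Pi.add_apply, map_add] at h6
    rw [h8, h9, zero_add, hU₀U _ _ _ _ (by rw [hl, hlev]; push_cast; linarith), h10] at h6
    rw [← h6]
    ring
  have key : ∀ j : ℕ, 2 * j + 1 ≤ N → Ω (j • γ + (j + 1) • γ') = 1 := by
    intro j
    induction j with
    | zero =>
      intro hj
      have := eq2 0 hj
      rw [hc0] at this
      simpa using this.symm
    | succ j ih =>
      intro hj
      have e1 := eq1 j (by omega)
      have e2 := eq2 (j + 1) hj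
      rw [ih (by omega), e2, pow_succ] at e1
      push_cast at e1
      have h5 : ((-1 : ℚ) ^ j * (j + 2)) ≠ 0 := mul_ne_zero (by simp) (by positivity)
      refine mul_right_cancel₀ h5 ?_
      linear_combination -e1
  exact key k (by omega)

/-! ### The charges of the SU(3) system -/

theorem pairing_nuPlus_nuMinus (k : Fin 3) : pairing (nuPlus k) (nuMinus k) = -2 := by
  fin_cases k <;> decide

theorem pairing_gamma1_gamma2 (n : ℕ) : pairing (gamma1 n) (gamma2 n) = -1 := by
  simp [pairing, gamma1, gamma2, coroot, root]

theorem gamma3_eq_add (n : ℕ) : gamma3 n = gamma1 n + gamma2 n := by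
  refine Prod.ext ?_ ?_ <;> funext i <;> fin_cases i <;>
    simp [gamma1, gamma2, gamma3, coroot, root] <;> ring

theorem gamma1_succ (k : ℕ) : gamma1 (k + 1) = k • nuPlus 0 + (k + 1) • nuMinus 0 := by
  refine Prod.ext ?_ ?_ <;> funext i <;> fin_cases i <;>
    simp [gamma1, nuPlus, nuMinus, coroot, root]

theorem gamma2_succ (k : ℕ) : gamma2 (k + 1) = k • nuPlus 1 + (k + 1) • nuMinus 1 := by
  refine Prod.ext ?_ ?_ <;> funext i <;> fin_cases i <;>
    simp [gamma2, nuPlus, nuMinus, coroot, root]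

theorem gamma3_succ (k : ℕ) : gamma3 (k + 1) = k • nuPlus 2 + (k + 1) • nuMinus 2 := by
  refine Prod.ext ?_ ?_ <;> funext i <;> fin_cases i <;>
    simp [gamma3, nuPlus, nuMinus, coroot, root] <;> ring

theorem gamma3_ne_gamma1 (n : ℕ) : gamma3 n ≠ gamma1 n := fun h => by
  have := congrFun (congrArg Prod.fst h) 1
  simp [gamma1, gamma3, coroot] at this

theorem gamma3_ne_gamma2 (n : ℕ) : gamma3 n ≠ gamma2 n := fun h => by
  have := congrFun (congrArg Prod.fst h) 0
  simp [gamma2, gamma3, coroot] at this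

/-- The dyons of the pair `ν_k^±` have invariant `1`; the auxiliary charges solve
`⟨ν_k^+,μ⟩ = -1`, `⟨ν_k^-,μ⟩ = 0` and `⟨ν_k^+,μ'⟩ = 0`, `⟨ν_k^-,μ'⟩ = 1`. -/
theorem apply_nu_dyon {Ω : Charge → ℚ} {k : Fin 3}
    (h : KSWCF (nuPlus k) (nuMinus k) (twoStates (nuPlus k) (nuMinus k)) Ω) (j : ℕ) :
    Ω (j • nuPlus k + (j + 1) • nuMinus k) = 1 := by
  fin_cases k
  · exact h.apply_dyon (pairing_nuPlus_nuMinus 0) (μ := (![0, 1], ![0, 0]))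
      (μ' := (![1, 1], ![1, 0])) (by decide) (by decide) (by decide) (by decide) j
  · exact h.apply_dyon (pairing_nuPlus_nuMinus 1) (μ := (![1, 0], ![0, 1]))
      (μ' := (![1, 1], ![0, 0])) (by decide) (by decide) (by decide) (by decide) j
  · exact h.apply_dyon (pairing_nuPlus_nuMinus 2) (μ := (![-1, 0], ![-1, 0]))
      (μ' := (![1, 0], ![2, 0])) (by decide) (by decide) (by decide) (by decide) j

/-- The cones of the pairs `ν_k^±` meet only in `0`. -/
theorem eq_of_nu_ray_eq {k k' : Fin 3} {m l m' l' : ℕ} (hml : 1 ≤ m + l)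
    (h : m • nuPlus k + l • nuMinus k = m' • nuPlus k' + l' • nuMinus k') : k = k' := by
  have h1 := congrFun (congrArg Prod.fst h) 0
  have h2 := congrFun (congrArg Prod.fst h) 1
  have h3 := congrFun (congrArg Prod.snd h) 0
  have h4 := congrFun (congrArg Prod.snd h) 1
  fin_cases k <;> fin_cases k' <;> first | rfl | skip
  all_goals
    simp [nuPlus, nuMinus, coroot, root] at h1 h2 h3 h4
    omega

/-- The formula sees the invariants of the nonzero charges of the cone only. -/
theorem KSWCF.congr_right {γ γ' : Charge} {Ω Ω₁ Ω₂ : Charge → ℚ} (h : KSWCF γ γ' Ω Ω₁)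
    (h12 : ∀ m l : ℕ, 1 ≤ m + l → Ω₁ (m • γ + l • γ') = Ω₂ (m • γ + l • γ')) :
    KSWCF γ γ' Ω Ω₂ :=
  kswcf_iff.2 fun N => KSWCFUpTo.congr (kswcf_iff.1 h N) fun m l hml _ => h12 m l hml

/-- The three cones meet in `0` only, so that the solutions of the three wall crossing formulas can
be glued. -/
theorem exists_isGeneratedSpectrum : ∃ Ω, IsGeneratedSpectrum Ω := by
  classical
  have hne : ∀ k, pairing (nuPlus k) (nuMinus k) ≠ 0 := fun k => by
    rw [pairing_nuPlus_nuMinus]; norm_num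
  choose Ω hΩ using fun k => exists_kswcf (hne k) (twoStates (nuPlus k) (nuMinus k))
  refine ⟨fun μ => if h : ∃ k, InCone (nuPlus k) (nuMinus k) μ then Ω h.choose μ else 0,
    fun k => (hΩ k).congr_right fun m l hml => ?_, fun μ hμ => ?_⟩
  · have h : ∃ k', InCone (nuPlus k') (nuMinus k') (m • nuPlus k + l • nuMinus k) :=
      ⟨k, m, l, rfl⟩
    obtain ⟨m', l', h'⟩ := h.choose_spec
    rw [dif_pos h, ← eq_of_nu_ray_eq hml h']
  · rw [dif_neg]
    rintro ⟨k, hk⟩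
    exact (hμ k).1 hk

theorem IsGeneratedSpectrum.apply_gamma {Ω : Charge → ℚ} (h : IsGeneratedSpectrum Ω) {n : ℕ}
    (hn : 1 ≤ n) : Ω (gamma1 n) = 1 ∧ Ω (gamma2 n) = 1 ∧ Ω (gamma3 n) = 1 := by
  obtain ⟨k, rfl⟩ : ∃ k, n = k + 1 := ⟨n - 1, by omega⟩
  rw [gamma1_succ, gamma2_succ, gamma3_succ]
  exact ⟨apply_nu_dyon (h.crossing 0) k, apply_nu_dyon (h.crossing 1) k,
    apply_nu_dyon (h.crossing 2) k⟩

/-! ### Crossing the wall of `γ₁` and `γ₂` -/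

theorem pairing_gamma1_gamma2_ne_zero (n : ℕ) : pairing (gamma1 n) (gamma2 n) ≠ 0 := by
  rw [pairing_gamma1_gamma2]; norm_num

theorem KSWCF.apply_gamma3 {n : ℕ} {Ω Ω' : Charge → ℚ} (h : KSWCF (gamma1 n) (gamma2 n) Ω Ω') :
    Ω' (gamma3 n) = Ω (gamma3 n) + Ω (gamma1 n) * Ω (gamma2 n) := by
  rw [gamma3_eq_add, h.apply_add (pairing_gamma1_gamma2_ne_zero n), coeff, pairing_gamma1_gamma2]
  norm_num

theorem crossingGives_gamma_twoStates (n : ℕ) : CrossingGives (gamma1 n) (gamma2 n)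
    (twoStates (gamma1 n) (gamma2 n)) (gamma3 n) 1 := by
  refine ⟨exists_kswcf (pairing_gamma1_gamma2_ne_zero n) _, fun Ω' h => ?_⟩
  rw [h.apply_gamma3]
  simp [twoStates, gamma3_ne_gamma1, gamma3_ne_gamma2]

theorem crossingGives_nu_twoStates {n : ℕ} (hn : 1 ≤ n) : CrossingGives (nuPlus 2) (nuMinus 2)
    (twoStates (nuPlus 2) (nuMinus 2)) (gamma3 n) 1 := by
  refine ⟨exists_kswcf (by rw [pairing_nuPlus_nuMinus]; norm_num) _, fun Ω' h => ?_⟩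
  obtain ⟨k, rfl⟩ : ∃ k, n = k + 1 := ⟨n - 1, by omega⟩
  rw [gamma3_succ]
  exact apply_nu_dyon h k

theorem IsGeneratedSpectrum.apply_gamma3_of_kswcf {Ω Ω' : Charge → ℚ}
    (hΩ : IsGeneratedSpectrum Ω) {n : ℕ} (hn : 1 ≤ n) (h : KSWCF (gamma1 n) (gamma2 n) Ω Ω') :
    Ω' (gamma3 n) = 2 := by
  obtain ⟨h1, h2, h3⟩ := hΩ.apply_gamma hn
  rw [h.apply_gamma3, h1, h2, h3]
  norm_num

/-! ### Central charges -/

theorem aligned_weakCentralCharge_iff (n : ℕ) {C : ℂ} (hC : C ≠ 0) (a : Fin 2 → ℂ) :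
    Aligned (weakCentralCharge C a) (gamma1 n) (gamma2 n) ↔
      a 1 ≠ 0 ∧ (a 0 / a 1).im = 0 ∧ 0 < (a 0 / a 1).re := by
  have h1 : weakCentralCharge C a (gamma1 n) = -(C * a 0) := by
    simp [weakCentralCharge, gamma1, coroot]
  have h2 : weakCentralCharge C a (gamma2 n) = -(C * a 1) := by
    simp [weakCentralCharge, gamma2, coroot]
  rw [Aligned, h1, h2, neg_ne_zero, mul_ne_zero_iff, and_iff_right hC]
  refine and_congr_right fun ha => ⟨?_, ?_⟩
  · rintro ⟨r, hr, h⟩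
    have : a 0 / a 1 = (r : ℂ) := by
      rw [div_eq_iff ha]
      refine mul_left_cancel₀ hC ?_
      linear_combination -h
    rw [this]
    exact ⟨Complex.ofReal_im r, by rwa [Complex.ofReal_re]⟩
  · rintro ⟨him, hre⟩
    refine ⟨(a 0 / a 1).re, hre, ?_⟩
    have : ((a 0 / a 1).re : ℂ) = a 0 / a 1 :=
      Complex.ext (Complex.ofReal_re _) (by rw [Complex.ofReal_im, him])
    rw [this]
    field_simp

theorem turn_ray (Z : Charge →+ ℂ) (γ γ' : Charge) (p q : ℕ × ℕ) :
    turn Z (p.1 • γ + p.2 • γ') (q.1 • γ + q.2 • γ') =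
      ((p.1 * q.2 : ℕ) - (q.1 * p.2 : ℕ) : ℝ) * turn Z γ γ' := by
  simp only [turn, map_add, map_nsmul]
  simp only [nsmul_eq_mul, star_add, star_mul', star_natCast,
    Complex.mul_im, Complex.add_im, Complex.add_re, Complex.mul_re, Complex.natCast_re,
    Complex.natCast_im, Complex.star_def, Complex.conj_re, Complex.conj_im]
  push_cast
  ring

theorem clockwise_of_turn_pos {Z : Charge →+ ℂ} {γ γ' : Charge} (h : 0 < turn Z γ γ') :
    clockwise Z γ γ' = fromFirst := by
  funext p q
  rw [clockwise, turn_ray, mul_pos_iff_of_pos_right h, sub_pos, Nat.cast_lt]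
  rfl

theorem clockwise_of_turn_neg {Z : Charge →+ ℂ} {γ γ' : Charge} (h : turn Z γ γ' < 0) :
    clockwise Z γ γ' = fromSecond := by
  funext p q
  rw [clockwise, turn_ray, ← neg_mul_neg, mul_pos_iff_of_pos_right (neg_pos.2 h), neg_sub, sub_pos,
    Nat.cast_lt]
  rfl

/-- The constancy of the clockwise product gives the wall crossing formula for each pair of nearby
points on the two sides. -/
theorem IsWCSNear.exists_kswcf {B : Type*} [TopologicalSpace B] {Z : B → Charge →+ ℂ}
    {Ω : B → Charge → ℚ} {γ γ' : Charge} {b₀ : B} (h : IsWCSNear Z Ω γ γ' b₀) :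
    ∃ U ∈ 𝓝 b₀, ∀ b ∈ U, ∀ b' ∈ U, 0 < turn (Z b) γ γ' → turn (Z b') γ γ' < 0 →
      KSWCF γ γ' (Ω b) (Ω b') := by
  obtain ⟨U, hU, hS⟩ := h
  refine ⟨U, hU, fun b hb b' hb' h1 h2 N => ?_⟩
  obtain ⟨S, hS⟩ := hS N
  have e1 := hS b hb h1.ne'
  have e2 := hS b' hb' h2.ne
  rw [clockwise_of_turn_pos h1] at e1
  rw [clockwise_of_turn_neg h2] at e2
  exact ⟨S, e1, e2⟩

end SU3

end

theorem proposition4p12 (n : ℕ) (hn : 1 ≤ n) :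
    -- the state of charge `γ₃` arises from two pairs of states
    (SU3.gamma3 n = SU3.gamma1 n + SU3.gamma2 n ∧
      SU3.gamma3 n = (n - 1) • SU3.nuPlus 2 + n • SU3.nuMinus 2) ∧
    -- the side where the walls of the pairs `νₖ^±` are present
    ((∃ Ω : SU3.Charge → ℚ, SU3.IsGeneratedSpectrum Ω) ∧
      (∀ Ω : SU3.Charge → ℚ, SU3.IsGeneratedSpectrum Ω →
        Ω (SU3.gamma1 n) = 1 ∧ Ω (SU3.gamma2 n) = 1 ∧ Ω (SU3.gamma3 n) = 1)) ∧
    -- the two ways, each of which alone gives invariant `1`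
    (SU3.CrossingGives (SU3.nuPlus 2) (SU3.nuMinus 2)
        (SU3.twoStates (SU3.nuPlus 2) (SU3.nuMinus 2)) (SU3.gamma3 n) 1 ∧
      SU3.CrossingGives (SU3.gamma1 n) (SU3.gamma2 n)
        (SU3.twoStates (SU3.gamma1 n) (SU3.gamma2 n)) (SU3.gamma3 n) 1) ∧
    -- the wall crossing formula turns the invariant `1` into `2`
    (∀ Ω : SU3.Charge → ℚ, SU3.IsGeneratedSpectrum Ω →
      SU3.CrossingGives (SU3.gamma1 n) (SU3.gamma2 n) Ω (SU3.gamma3 n) 2) ∧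
    -- the wall at weak coupling
    (∀ (C : ℂ) (a : Fin 2 → ℂ), C ≠ 0 →
      (SU3.Aligned (SU3.weakCentralCharge C a) (SU3.gamma1 n) (SU3.gamma2 n) ↔
        a 1 ≠ 0 ∧ (a 0 / a 1).im = 0 ∧ 0 < (a 0 / a 1).re)) ∧
    -- the jump in any family of central charges and invariants that crosses the wall
    (∀ (B : Type*) [TopologicalSpace B] (Z : B → SU3.Charge →+ ℂ) (Ω : B → SU3.Charge → ℚ) (b₀ : B),
      (∀ γ, Continuous fun b => Z b γ) →
      b₀ ∈ SU3.wall Z (SU3.gamma1 n) (SU3.gamma2 n) →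
      SU3.IsWCSNear Z Ω (SU3.gamma1 n) (SU3.gamma2 n) b₀ →
      (𝓝[{b | 0 < SU3.turn (Z b) (SU3.gamma1 n) (SU3.gamma2 n)}] b₀).NeBot →
      (∀ᶠ b in 𝓝[{b | 0 < SU3.turn (Z b) (SU3.gamma1 n) (SU3.gamma2 n)}] b₀,
        SU3.IsGeneratedSpectrum (Ω b)) →
      (∀ᶠ b in 𝓝[{b | 0 < SU3.turn (Z b) (SU3.gamma1 n) (SU3.gamma2 n)}] b₀,
        Ω b (SU3.gamma3 n) = 1) ∧
      (∀ᶠ b in 𝓝[{b | SU3.turn (Z b) (SU3.gamma1 n) (SU3.gamma2 n) < 0}] b₀,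
        Ω b (SU3.gamma3 n) = 2)) := by
  refine ⟨⟨SU3.gamma3_eq_add n, ?_⟩, ⟨SU3.exists_isGeneratedSpectrum, fun Ω h => h.apply_gamma hn⟩,
    ⟨SU3.crossingGives_nu_twoStates hn, SU3.crossingGives_gamma_twoStates n⟩,
    fun Ω h => ⟨SU3.exists_kswcf (SU3.pairing_gamma1_gamma2_ne_zero n) Ω,
      fun Ω' h' => h.apply_gamma3_of_kswcf hn h'⟩,
    fun C a hC => SU3.aligned_weakCentralCharge_iff n hC a, ?_⟩
  · obtain ⟨k, rfl⟩ : ∃ k, n = k + 1 := ⟨n - 1, by omega⟩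
    rw [SU3.gamma3_succ, Nat.add_sub_cancel]
  · intro B _ Z Ω b₀ _ _ hW hne hgen
    refine ⟨hgen.mono fun b hb => (hb.apply_gamma hn).2.2, ?_⟩
    obtain ⟨U, hU, hK⟩ := hW.exists_kswcf
    -- a reference point on the side `B₋`; it exists because `b₀` lies in the closure of `B₋`
    obtain ⟨b, ⟨hb, hbU⟩, hb0⟩ :=
      ((hgen.and (mem_nhdsWithin_of_mem_nhds hU)).and self_mem_nhdsWithin).exists
    filter_upwards [mem_nhdsWithin_of_mem_nhds hU, self_mem_nhdsWithin] with b' hbU' hb'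
    exact hb.apply_gamma3_of_kswcf hn (hK b hbU b' hbU' hb0 hb')
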